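/- Let $C\subset\mathbb{R}^n$ be a closed convex cone with nonempty interior which is pointed, i.e. $C\cap(-C)=\{o\}$. Let $C^\circ=\{x : \langle x,y\rangle\le 0\ \forall y\in C\}$, $\Omega_C=\operatorname{int}C\cap\mathbb{S}^{n-1}$, $\Omega_{C^\circ}=\operatorname{int}C^\circ\cap\mathbb{S}^{n-1}$, fix $\mathfrak{u}\in\Omega_C\cap(-\Omega_{C^\circ})$, and put $C^-(t)=\{x\in C : \langle x,\mathfrak{u}\rangle\le t\}$. A $C$-pseudo-cone is a nonempty closed convex set $E\subset C$ with $o\notin E$, with $\lambda x\in E$ for all $x\in E$ and $\lambda\ge 1$, and with recession cone $\{x : E+x\subset E\}$ equal to $C$. For $v\in\Omega_{C^\circ}$ let $h_E(v)=\sup\{\langle x,v\rangle : x\in E\}$. For a nonempty compact set $\omega\subset\Omega_{C^\circ}$ let $\mathcal{K}(C,\omega)$ be the class of all $C$-pseudo-cones $K$ with $$K=C\cap\bigcap_{v\in\omega}\{x : \langle x,v\rangle\le h_K(v)\}.$$ The Gaussian surface area measure of a $C$-pseudo-cone $E$ is given, for Borel sets $A\subset\Omega_{C^\circ}$, by $$S_{\gamma_n}(E,A)=\frac{1}{(2\pi)^{n/2}}\int_{\boldsymbol{\nu}^*_E(A)}e^{-|x|^2/2}\,d\mathcal{H}^{n-1}(x),$$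 where $\boldsymbol{\nu}^*_E(A)=\{x\in\partial E\cap\operatorname{int}C : \langle x,v\rangle=h_E(v)\text{ for some }v\in A\}$ and $\mathcal{H}^{n-1}$ is the $(n-1)$-dimensional Hausdorff measure. $C$-pseudo-cones $E_i$ $(i\ge1)$ converge to a $C$-pseudo-cone $E_0$ in Schneider's sense if there is $t_0>0$ such that $E_i\cap C^-(t_0)\neq\emptyset$ for all $i\ge 0$ and, for every $t\ge t_0$, $E_i\cap C^-(t)\to E_0\cap C^-(t)$ in the Hausdorff metric as $i\to\infty$. **Lemma.** Let $\omega\subset\Omega_{C^\circ}$ be a nonempty compact set, and let $K_i\in\mathcal{K}(C,\omega)$ $(i\ge 1)$ converge in Schneider's sense to $K_0\in\mathcal{K}(C,\omega)$. Then the set functions $S_{\gamma_n}(K_i,\cdot)$ $(i\ge0)$ are finite Borel measures on $\Omega_{C^\circ}$, and $S_{\gamma_n}(K_i,\cdot)$ converges weakly to $S_{\gamma_n}(K_0,\cdot)$ as $i\to\infty$, i.e. $\int f\,dS_{\gamma_n}(K_i,\cdot)\to\int f\,dS_{\gamma_n}(K_0,\cdot)$ for every bounded continuous $f:\Omega_{C^\circ}\to\mathbb{R}$.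 -/

import Mathlib

open MeasureTheory Filter Topology
open scoped ENNReal

noncomputable section

namespace GaussPseudoCone

variable {n : ℕ}

/-- The polar cone `C° = {x | ⟨x, y⟩ ≤ 0 for all y ∈ C}`. -/
def polarCone (C : Set (EuclideanSpace ℝ (Fin n))) : Set (EuclideanSpace ℝ (Fin n)) :=
  {x | ∀ y ∈ C, inner ℝ x y ≤ 0}

/-- `Ω_C = int C ∩ S^{n-1}`. -/
def sphInterior (C : Set (EuclideanSpace ℝ (Fin n))) : Set (EuclideanSpace ℝ (Fin n)) :=
  interior C ∩ Metric.sphere 0 1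

/-- The recession cone `rec E = {x | E + x ⊆ E}`. -/
def recCone (E : Set (EuclideanSpace ℝ (Fin n))) : Set (EuclideanSpace ℝ (Fin n)) :=
  {x | ∀ y ∈ E, y + x ∈ E}

/-- `E` is a `C`-pseudo-cone. -/
structure IsPseudoCone (C E : Set (EuclideanSpace ℝ (Fin n))) : Prop where
  nonempty : E.Nonempty
  isClosed : IsClosed E
  convex : Convex ℝ E
  zero_notMem : (0 : EuclideanSpace ℝ (Fin n)) ∉ E
  subset : E ⊆ C
  smul_mem : ∀ l : ℝ, 1 ≤ l → ∀ x ∈ E, l • x ∈ E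
  recCone_eq : recCone E = C

/-- The support function `h_E(v) = sup {⟨x, v⟩ | x ∈ E}`. It is used only for a pseudo-cone `E`
and `v ∈ Ω_{C°}`, where the set is nonempty and bounded above by `0`. -/
def supportFun (E : Set (EuclideanSpace ℝ (Fin n))) (v : EuclideanSpace ℝ (Fin n)) : ℝ :=
  sSup ((fun x => inner ℝ x v) '' E)

/-- `K` is a `C`-determined set by `ω`, i.e. `K ∈ 𝒦(C, ω)`: it is a `C`-pseudo-cone and
`K = C ∩ ⋂_{v ∈ ω} H⁻(v, h_K(v))`. -/
structure IsDetermined (C ω K : Set (EuclideanSpace ℝ (Fin n))) : Prop where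
  isPseudoCone : IsPseudoCone C K
  eq_inter : K = C ∩ ⋂ v ∈ ω, {x | inner ℝ x v ≤ supportFun K v}

/-- The truncated cone `C⁻(t) = {x ∈ C | ⟨x, 𝔲⟩ ≤ t}`. -/
def truncCone (C : Set (EuclideanSpace ℝ (Fin n))) (u : EuclideanSpace ℝ (Fin n)) (t : ℝ) :
    Set (EuclideanSpace ℝ (Fin n)) :=
  {x ∈ C | inner ℝ x u ≤ t}

/-- Convergence of `K i` to `K₀` in the sense of Schneider: for some `t₀ > 0` all truncations at
`t₀` are nonempty, and for every `t ≥ t₀` the truncations `K i ∩ C⁻(t)` converge to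
`K₀ ∩ C⁻(t)` in the Hausdorff metric. -/
def SchneiderTendsto (C : Set (EuclideanSpace ℝ (Fin n))) (u : EuclideanSpace ℝ (Fin n))
    (K : ℕ → Set (EuclideanSpace ℝ (Fin n))) (K₀ : Set (EuclideanSpace ℝ (Fin n))) : Prop :=
  ∃ t₀ : ℝ, 0 < t₀ ∧ (K₀ ∩ truncCone C u t₀).Nonempty ∧
    (∀ i, (K i ∩ truncCone C u t₀).Nonempty) ∧
    ∀ t : ℝ, t₀ ≤ t →
      Tendsto (fun i => Metric.hausdorffEDist (K i ∩ truncCone C u t) (K₀ ∩ truncCone C u t))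
        atTop (𝓝 0)

/-- The inverse Gauss image `ν*_E(ω)`: the points of `∂E ∩ int C` at which some `v ∈ ω` is an
outer normal vector of `E`. -/
def inverseGaussImage (C E ω : Set (EuclideanSpace ℝ (Fin n))) :
    Set (EuclideanSpace ℝ (Fin n)) :=
  {x ∈ frontier E ∩ interior C | ∃ v ∈ ω, inner ℝ x v = supportFun E v}

/-- The `k`-dimensional Hausdorff measure in the usual normalization, in which a unit cube of
dimension `k` has measure one: Mathlib's `μH[k]`, which is built from `diam ^ k` alone, times
the volume of the `k`-dimensional ball of diameter one. -/
def hausdorff (k : ℕ) : Measure (EuclideanSpace ℝ (Fin n)) :=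
  (volume (Metric.ball (0 : EuclideanSpace ℝ (Fin k)) (1 / 2))) • Measure.hausdorffMeasure (k : ℝ)

/-- The value `S_{γ_n}(E, ω) = (2π)^{-n/2} ∫_{ν*_E(ω)} exp (-|x|² / 2) dℋ^{n-1}(x)`. -/
def gaussSurfaceArea (C E ω : Set (EuclideanSpace ℝ (Fin n))) : ℝ≥0∞ :=
  ENNReal.ofReal (1 / (2 * Real.pi) ^ ((n : ℝ) / 2)) *
    ∫⁻ x in inverseGaussImage C E ω, ENNReal.ofReal (Real.exp (-‖x‖ ^ 2 / 2)) ∂(hausdorff (n - 1))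

/-- The finite Borel measure `μ` on `Ω_{C°}` is the Gaussian surface area measure `S_{γ_n}(E, ·)`.
There is at most one such `μ`, as its value on every Borel set is prescribed. -/
def IsGaussSurfaceAreaMeasure (C E : Set (EuclideanSpace ℝ (Fin n)))
    (μ : FiniteMeasure (sphInterior (polarCone C))) : Prop :=
  ∀ A : Set (sphInterior (polarCone C)), MeasurableSet A →
    (μ : Measure (sphInterior (polarCone C))) A = gaussSurfaceArea C E (Subtype.val '' A)

end GaussPseudoCone

end

/-! Since `u` is interior to `C` and `-u` is interior to the polar cone, a ball of some radius `r`
about `u` lies in `C`, and `C` lies in the half-space `⟨x, u⟩ ≥ 0`. Every `C`-pseudo-cone is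
therefore the epigraph, over the hyperplane `u^⊥`, of a convex function `heightFun u K` with the
common Lipschitz constant `r⁻¹`, and its boundary is the graph. By Rademacher's theorem this
function is differentiable almost everywhere, and at such points `normalDir` is the only possible
unit normal in the polar cone. The area formula then writes the Gaussian surface area measure as the
push-forward, under the Gauss map, of a density on `u^⊥`: a constant times `graphFactor` of the
derivative, times the Gaussian weight, cut off to the points whose graph point is in `int C`
(`gaussMeasure_apply`). The explicit Jacobian is never needed, only its continuity and a bound.

Schneider convergence gives pointwise convergence of the height functions (`tendsto_heightFun`), and
convexity upgrades this to convergence of derivatives wherever all of them exist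
(`tendsto_fderiv_of_convexOn`). So densities and normals converge almost everywhere, under a
Gaussian bound that does not depend on `K`, and dominated convergence applies.

The delicate points are those where the limit graph meets the boundary of `C`, since the cut-off is
discontinuous there. Over `int C` all normals of a determined set belong to the compact set `ω`
(`normalDir_mem`), while at a boundary point of `C` the normal is outside `Ω_{C°}`
(`normalDir_notMem`). Convergence of normals thus forces the approximating graph points out of `int
C` eventually. -/

noncomputable section

namespace GaussPseudoCone

open scoped NNReal Function
open Set Module

/-! ### Graphs over a hyperplane and the area formula -/

section Area

variable {E : Type*} [NormedAddCommGroup E] [InnerProductSpace ℝ E]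

theorem inner_coe_orthogonal (u : E) (w : (Submodule.span ℝ {u})ᗮ) : inner ℝ (w : E) u = 0 := by
  have := Submodule.mem_orthogonal_singleton_iff_inner_left.1 w.2
  exact this

theorem norm_sq_coe_add_smul {u : E} (hu : ‖u‖ = 1) (w : (Submodule.span ℝ {u})ᗮ) (t : ℝ) :
    ‖(w : E) + t • u‖ ^ 2 = ‖w‖ ^ 2 + t ^ 2 := by
  rw [norm_add_sq_real, inner_smul_right, inner_coe_orthogonal, norm_smul, hu]
  simp

theorem norm_le_norm_coe_add_smul {u : E} (hu : ‖u‖ = 1) (w : (Submodule.span ℝ {u})ᗮ) (t : ℝ) :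
    ‖w‖ ≤ ‖(w : E) + t • u‖ := by
  refine le_of_sq_le_sq ?_ (norm_nonneg _)
  rw [norm_sq_coe_add_smul hu]
  nlinarith [sq_nonneg t]

theorem abs_le_norm_coe_add_smul {u : E} (hu : ‖u‖ = 1) (w : (Submodule.span ℝ {u})ᗮ) (t : ℝ) :
    |t| ≤ ‖(w : E) + t • u‖ := by
  refine le_of_sq_le_sq ?_ (norm_nonneg _)
  rw [norm_sq_coe_add_smul hu, sq_abs]
  nlinarith [sq_nonneg ‖w‖]

/-- The graph over the hyperplane `u^⊥`, in direction `u`, of a real function. -/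
def graphMap (u : E) (f : (Submodule.span ℝ {u})ᗮ → ℝ) (y : (Submodule.span ℝ {u})ᗮ) : E :=
  (y : E) + f y • u

/-- The graph over `u^⊥` of a linear functional, as a linear map. -/
def graphLin (u : E) (A : (Submodule.span ℝ {u})ᗮ →L[ℝ] ℝ) : (Submodule.span ℝ {u})ᗮ →L[ℝ] E :=
  (Submodule.span ℝ {u})ᗮ.subtypeL + A.smulRight u

theorem graphMap_sub (u : E) (f : (Submodule.span ℝ {u})ᗮ → ℝ) (x y : (Submodule.span ℝ {u})ᗮ) :
    graphMap u f x - graphMap u f y = ((x - y : (Submodule.span ℝ {u})ᗮ) : E) + (f x - f y) • u := by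
  simp only [graphMap, Submodule.coe_sub, sub_smul]; abel

theorem antilipschitz_graphMap {u : E} (hu : ‖u‖ = 1) (f : (Submodule.span ℝ {u})ᗮ → ℝ) :
    AntilipschitzWith 1 (graphMap u f) := by
  refine AntilipschitzWith.of_le_mul_dist fun x y => ?_
  rw [dist_eq_norm, dist_eq_norm, graphMap_sub, NNReal.coe_one, one_mul]
  exact norm_le_norm_coe_add_smul hu _ _

theorem graphMap_injective {u : E} (hu : ‖u‖ = 1) (f : (Submodule.span ℝ {u})ᗮ → ℝ) :
    Function.Injective (graphMap u f) := (antilipschitz_graphMap hu f).injective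

theorem continuous_graphMap (u : E) {f : (Submodule.span ℝ {u})ᗮ → ℝ} (hf : Continuous f) :
    Continuous (graphMap u f) := by unfold graphMap; fun_prop

theorem lipschitz_graphMap {u : E} (hu : ‖u‖ = 1) {f : (Submodule.span ℝ {u})ᗮ → ℝ} {L : ℝ≥0}
    (hf : LipschitzWith L f) : LipschitzWith (1 + L) (graphMap u f) := by
  refine LipschitzWith.of_dist_le_mul fun x y => ?_
  rw [dist_eq_norm, graphMap_sub]
  refine (norm_add_le _ _).trans ?_
  have := hf.dist_le_mul x y
  rw [Real.dist_eq] at this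
  rw [norm_smul, hu, mul_one, Real.norm_eq_abs, NNReal.coe_add, NNReal.coe_one, add_mul, one_mul,
    dist_eq_norm]
  rw [dist_eq_norm] at this
  exact add_le_add le_rfl this

theorem graphMap_coe_clm (u : E) (A : (Submodule.span ℝ {u})ᗮ →L[ℝ] ℝ) :
    graphMap u A = graphLin u A := rfl

/-- If the increments of `g` and `f` over a set differ by at most `ε` times the distance, then the
graph of `g` has at most `(1 + ε) ^ d` times the measure of the graph of `f`. -/
theorem hausdorffMeasure_graph_le [MeasurableSpace E] [BorelSpace E] {u : E} (hu : ‖u‖ = 1)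
    {f g : (Submodule.span ℝ {u})ᗮ → ℝ} {ε : ℝ≥0} {s : Set (Submodule.span ℝ {u})ᗮ}
    (h : ∀ x ∈ s, ∀ y ∈ s, |(g x - g y) - (f x - f y)| ≤ ε * ‖x - y‖) {d : ℝ} (hd : 0 ≤ d) :
    μH[d] (graphMap u g '' s) ≤ ((1 + ε : ℝ≥0) : ℝ≥0∞) ^ d * μH[d] (graphMap u f '' s) := by
  -- The map from one graph to the other that keeps the base point is `(1 + ε)`-Lipschitz: it
  -- changes only the vertical increment, by at most `ε` times a base distance that is itself at
  -- most the distance in the graph of `f`.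
  set F := Function.invFun (graphMap u f)
  have hF : ∀ y, F (graphMap u f y) = y := Function.leftInverse_invFun (graphMap_injective hu f)
  have him : graphMap u g '' s = (graphMap u g ∘ F) '' (graphMap u f '' s) := by
    rw [image_image]
    refine image_congr fun y _ => ?_
    simp [hF]
  rw [him]
  refine LipschitzOnWith.hausdorffMeasure_image_le ?_ hd
  refine LipschitzOnWith.of_dist_le_mul ?_
  rintro _ ⟨x, hx, rfl⟩ _ ⟨y, hy, rfl⟩
  simp only [Function.comp, hF]
  rw [dist_eq_norm, dist_eq_norm, NNReal.coe_add, NNReal.coe_one, add_mul, one_mul]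
  have e : graphMap u g x - graphMap u g y
      = (graphMap u f x - graphMap u f y) + ((g x - g y) - (f x - f y)) • u := by
    rw [graphMap_sub, graphMap_sub, sub_smul _ (f x - f y) u]; abel
  rw [e]
  refine (norm_add_le _ _).trans (add_le_add le_rfl ?_)
  rw [norm_smul, hu, mul_one, Real.norm_eq_abs]
  refine (h x hx y hy).trans ?_
  rw [graphMap_sub]
  exact mul_le_mul_of_nonneg_left (norm_le_norm_coe_add_smul hu _ _) ε.2

variable [FiniteDimensional ℝ E] [MeasurableSpace E] [BorelSpace E]

theorem measurableEmbedding_graphMap {u : E} (hu : ‖u‖ = 1) {f : (Submodule.span ℝ {u})ᗮ → ℝ}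
    (hf : Continuous f) : MeasurableEmbedding (graphMap u f) :=
  (continuous_graphMap u hf).measurableEmbedding (graphMap_injective hu f)

/-- Hausdorff measure of top dimension on the hyperplane `u^⊥`. -/
def hyperMeasure (u : E) : Measure (Submodule.span ℝ {u})ᗮ :=
  μH[finrank ℝ (Submodule.span ℝ {u})ᗮ]

instance isAddHaarMeasure_hyperMeasure (u : E) : (hyperMeasure u).IsAddHaarMeasure :=
  isAddHaarMeasure_hausdorffMeasure

/-- The measure of graphs of a linear functional, as a measure on the hyperplane. -/
def graphMeasure (u : E) (A : (Submodule.span ℝ {u})ᗮ →L[ℝ] ℝ) : Measure (Submodule.span ℝ {u})ᗮ :=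
  Measure.comap (graphMap u A) μH[finrank ℝ (Submodule.span ℝ {u})ᗮ]

theorem graphMeasure_apply {u : E} (hu : ‖u‖ = 1) (A : (Submodule.span ℝ {u})ᗮ →L[ℝ] ℝ)
    (s : Set (Submodule.span ℝ {u})ᗮ) :
    graphMeasure u A s = μH[finrank ℝ (Submodule.span ℝ {u})ᗮ] (graphMap u A '' s) :=
  (measurableEmbedding_graphMap hu A.continuous).comap_apply _ _

/-- The factor by which the graph map of a linear functional multiplies the measure. -/
def graphFactor (u : E) (A : (Submodule.span ℝ {u})ᗮ →L[ℝ] ℝ) : ℝ≥0 :=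
  (graphMeasure u A (Metric.ball 0 1) / hyperMeasure u (Metric.ball 0 1)).toNNReal

/-- Uniqueness of Haar measure: translating the base translates the linear graph, which is an
isometry of `E`, and the Lipschitz bound makes the pulled-back measure finite on compact sets. The
ball in `graphFactor` only reads off the proportionality constant. -/
theorem hausdorffMeasure_graphMap_clm {u : E} (hu : ‖u‖ = 1)
    (A : (Submodule.span ℝ {u})ᗮ →L[ℝ] ℝ) (s : Set (Submodule.span ℝ {u})ᗮ) :
    μH[finrank ℝ (Submodule.span ℝ {u})ᗮ] (graphMap u A '' s)
      = graphFactor u A * hyperMeasure u s := by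
  have hinv : (graphMeasure u A).IsAddLeftInvariant := by
    refine ⟨fun a => ?_⟩
    ext s hs
    rw [Measure.map_apply (measurable_const_add a) hs, graphMeasure_apply hu, graphMeasure_apply hu]
    have : graphMap u A '' ((fun x => a + x) ⁻¹' s)
        = IsometryEquiv.addLeft (-graphMap u A a) '' (graphMap u A '' s) := by
      rw [image_image]
      ext x
      simp only [graphMap_coe_clm, IsometryEquiv.addLeft_apply, mem_image, mem_preimage]
      constructor
      · rintro ⟨y, hy, rfl⟩
        exact ⟨a + y, hy, by simp⟩
      · rintro ⟨y, hy, rfl⟩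
        exact ⟨-a + y, by simpa using hy, by simp⟩
    rw [this, IsometryEquiv.hausdorffMeasure_image]
  have hfin : IsFiniteMeasureOnCompacts (graphMeasure u A) := by
    refine ⟨fun k hk => ?_⟩
    rw [graphMeasure_apply hu]
    refine ((lipschitz_graphMap hu A.lipschitz).hausdorffMeasure_image_le
      (Nat.cast_nonneg _) k).trans_lt ?_
    refine ENNReal.mul_lt_top (ENNReal.rpow_lt_top_of_nonneg (Nat.cast_nonneg _)
      ENNReal.coe_ne_top) ?_
    exact hk.measure_lt_top (μ := hyperMeasure u)
  have := Measure.isAddLeftInvariant_eq_smul (graphMeasure u A) (hyperMeasure u)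
  have h0 : hyperMeasure u (Metric.ball 0 1) ≠ 0 := (Metric.measure_ball_pos _ _ one_pos).ne'
  have h1 : hyperMeasure u (Metric.ball 0 1) ≠ ∞ := measure_ball_lt_top.ne
  have hc : graphFactor u A = Measure.addHaarScalarFactor (graphMeasure u A) (hyperMeasure u) := by
    rw [graphFactor, congrFun (congrArg DFunLike.coe this) (Metric.ball 0 1),
      Measure.smul_apply, ENNReal.smul_def, smul_eq_mul, ENNReal.mul_div_cancel_right h0 h1,
      ENNReal.toNNReal_coe]
  rw [← graphMeasure_apply hu, hc, congrFun (congrArg DFunLike.coe this) s, Measure.smul_apply,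
    ENNReal.smul_def, smul_eq_mul]

theorem graphFactor_le_mul {u : E} (hu : ‖u‖ = 1) (A B : (Submodule.span ℝ {u})ᗮ →L[ℝ] ℝ)
    {ε : ℝ≥0} (h : ‖B - A‖ ≤ ε) :
    graphFactor u B ≤ (1 + ε) ^ finrank ℝ (Submodule.span ℝ {u})ᗮ * graphFactor u A := by
  set s : Set (Submodule.span ℝ {u})ᗮ := Metric.ball 0 1
  have h0 : hyperMeasure u s ≠ 0 := (Metric.measure_ball_pos _ _ one_pos).ne'
  have h1 : hyperMeasure u s ≠ ∞ := measure_ball_lt_top.ne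
  have := hausdorffMeasure_graph_le hu (f := A) (g := B) (ε := ε) (s := s)
    (d := (finrank ℝ (Submodule.span ℝ {u})ᗮ : ℝ)) (fun x _ y _ => by
      have := (B - A).le_of_opNorm_le h (x - y)
      simpa using this) (Nat.cast_nonneg _)
  rw [hausdorffMeasure_graphMap_clm hu, hausdorffMeasure_graphMap_clm hu, ← mul_assoc,
    ENNReal.mul_le_mul_iff_left h0 h1, ENNReal.rpow_natCast] at this
  exact_mod_cast this

theorem graphFactor_zero {u : E} (hu : ‖u‖ = 1) : graphFactor u 0 ≤ 1 := by
  set s : Set (Submodule.span ℝ {u})ᗮ := Metric.ball 0 1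
  have h0 : hyperMeasure u s ≠ 0 := (Metric.measure_ball_pos _ _ one_pos).ne'
  have h1 : hyperMeasure u s ≠ ∞ := measure_ball_lt_top.ne
  have hL : LipschitzWith 1 (graphMap u (0 : (Submodule.span ℝ {u})ᗮ →L[ℝ] ℝ)) := by
    have := lipschitz_graphMap hu (LipschitzWith.const (α := (Submodule.span ℝ {u})ᗮ) (0 : ℝ))
    rw [add_zero] at this
    exact this
  have := hL.hausdorffMeasure_image_le (d := (finrank ℝ (Submodule.span ℝ {u})ᗮ : ℝ))
    (Nat.cast_nonneg _) s
  rw [hausdorffMeasure_graphMap_clm hu, ENNReal.coe_one, ENNReal.one_rpow] at this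
  change _ ≤ 1 * hyperMeasure u s at this
  rw [ENNReal.mul_le_mul_iff_left h0 h1] at this
  exact_mod_cast this

theorem graphFactor_le {u : E} (hu : ‖u‖ = 1) (A : (Submodule.span ℝ {u})ᗮ →L[ℝ] ℝ)
    {L : ℝ≥0} (h : ‖A‖ ≤ L) :
    graphFactor u A ≤ (1 + L) ^ finrank ℝ (Submodule.span ℝ {u})ᗮ := by
  refine (graphFactor_le_mul hu 0 A (ε := L) (by simpa using h)).trans ?_
  exact mul_le_of_le_one_right (zero_le) (graphFactor_zero hu)

/-- The comparison `graphFactor_le_mul`, used in both directions, squeezes the factor at `B` between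
multiples of the factor at `A` that tend to it. -/
theorem continuous_graphFactor {u : E} (hu : ‖u‖ = 1) : Continuous (graphFactor u) := by
  refine continuous_iff_continuousAt.2 fun A => ?_
  set d := finrank ℝ (Submodule.span ℝ {u})ᗮ
  have hn : Tendsto (fun B => (1 + ‖B - A‖₊) ^ d) (𝓝 A) (𝓝 1) := by
    have : Continuous fun B : (Submodule.span ℝ {u})ᗮ →L[ℝ] ℝ => (1 + ‖B - A‖₊) ^ d := by fun_prop
    have h0 : ‖A - A‖₊ = 0 := by
      rw [sub_self]
      exact nnnorm_zero (E := (Submodule.span ℝ {u})ᗮ →L[ℝ] ℝ)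
    simpa only [h0, add_zero, one_pow] using this.tendsto A
  have hup : Tendsto (fun B => (1 + ‖B - A‖₊) ^ d * graphFactor u A) (𝓝 A)
      (𝓝 (graphFactor u A)) := by
    simpa using hn.mul_const (graphFactor u A)
  have hlo : Tendsto (fun B => ((1 + ‖B - A‖₊) ^ d)⁻¹ * graphFactor u A) (𝓝 A)
      (𝓝 (graphFactor u A)) := by
    simpa using (hn.inv₀ one_ne_zero).mul_const (graphFactor u A)
  refine tendsto_of_tendsto_of_tendsto_of_le_of_le hlo hup (fun B => ?_) fun B => ?_
  · have := graphFactor_le_mul hu B A (ε := ‖B - A‖₊) (norm_sub_rev A B).le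
    simp only
    rwa [inv_mul_le_iff₀ (by positivity)]
  · exact graphFactor_le_mul hu A B le_rfl

/-- Multiplying by a fixed unit vector `e` turns the functional into a map `V → V` without changing
norms, which reduces the claim to `ApproximatesLinearOn.norm_fderiv_sub_le`. The trivial space has
no such `e` and is treated apart. -/
theorem norm_fderiv_sub_le_of_approximatesLinearOn {V : Type*} [NormedAddCommGroup V]
    [NormedSpace ℝ V] [FiniteDimensional ℝ V] [MeasurableSpace V] [BorelSpace V] (μ : Measure V)
    [μ.IsAddHaarMeasure] {f : V → ℝ} {s : Set V} (hs : MeasurableSet s)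
    {A : V →L[ℝ] ℝ} {δ : ℝ≥0} (h : ApproximatesLinearOn f A s δ)
    (hd : ∀ x ∈ s, DifferentiableAt ℝ f x) :
    ∀ᵐ x ∂μ.restrict s, ‖fderiv ℝ f x - A‖ ≤ δ := by
  rcases subsingleton_or_nontrivial V with hV | hV
  · refine Eventually.of_forall fun x => ?_
    have : fderiv ℝ f x - A = 0 := by
      ext v; rw [Subsingleton.elim v 0]; simp
    rw [this, norm_zero]; exact δ.2
  obtain ⟨e, he⟩ := exists_norm_eq V zero_le_one
  have h1 : ApproximatesLinearOn (fun x => f x • e) (A.smulRight e) s δ := by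
    intro x hx y hy
    have := h x hx y hy
    simp only [ContinuousLinearMap.smulRight_apply]
    rw [← sub_smul, ← sub_smul, norm_smul, he, mul_one]
    exact this
  have h2 := h1.norm_fderiv_sub_le μ hs (fun x => (fderiv ℝ f x).smulRight e) fun x hx =>
    ((hd x hx).hasFDerivAt.smul_const e).hasFDerivWithinAt
  filter_upwards [h2] with x hx
  have : (fderiv ℝ f x).smulRight e - A.smulRight e = (fderiv ℝ f x - A).smulRight e := by
    ext v; simp [sub_smul]
  rw [this] at hx
  have hx' : ‖(fderiv ℝ f x - A).smulRight e‖ ≤ δ := hx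
  rwa [ContinuousLinearMap.norm_smulRight_apply, he, mul_one] at hx'

/-- **Area formula** for the graph of a function on a set of differentiability points. -/
theorem hausdorffMeasure_graphMap_of_differentiable {u : E} (hu : ‖u‖ = 1)
    {f : (Submodule.span ℝ {u})ᗮ → ℝ} (hf : Continuous f)
    {s : Set (Submodule.span ℝ {u})ᗮ} (hs : MeasurableSet s)
    (hd : ∀ x ∈ s, DifferentiableAt ℝ f x) :
    μH[finrank ℝ (Submodule.span ℝ {u})ᗮ] (graphMap u f '' s)
      = ∫⁻ y in s, graphFactor u (fderiv ℝ f y) ∂(hyperMeasure u) := by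
  set d := finrank ℝ (Submodule.span ℝ {u})ᗮ
  -- Cut `s` into countably many pieces on which `f` is `ε`-close to a linear functional. One factor
  -- `(1 + ε) ^ d` pays for replacing the graph by the linear one, the other for replacing
  -- `graphFactor` of the derivative by that of the functional; then `ε → 0`.
  have key : ∀ ε : ℝ≥0, 0 < ε →
      μH[d] (graphMap u f '' s) ≤ (((1 + ε) ^ (2 * d) : ℝ≥0) : ℝ≥0∞) *
        ∫⁻ y in s, graphFactor u (fderiv ℝ f y) ∂(hyperMeasure u) ∧
      ∫⁻ y in s, graphFactor u (fderiv ℝ f y) ∂(hyperMeasure u)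
        ≤ (((1 + ε) ^ (2 * d) : ℝ≥0) : ℝ≥0∞) * μH[d] (graphMap u f '' s) := by
    intro ε hε
    obtain ⟨t, A, t_disj, t_meas, t_cover, ht, -⟩ :=
      exists_partition_approximatesLinearOn_of_hasFDerivWithinAt f s (fderiv ℝ f)
        (fun x hx => (hd x hx).hasFDerivAt.hasFDerivWithinAt) (fun _ => ε) (fun _ => hε.ne')
    have hsu : s = ⋃ n, s ∩ t n := by rw [← inter_iUnion, inter_eq_left.2 t_cover]
    have hdisj : Pairwise (Disjoint on fun n => s ∩ t n) := fun i j hij =>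
      (t_disj hij).mono inter_subset_right inter_subset_right
    have hm : ∀ n, MeasurableSet (s ∩ t n) := fun n => hs.inter (t_meas n)
    have hI : ∫⁻ y in s, graphFactor u (fderiv ℝ f y) ∂(hyperMeasure u)
        = ∑' n, ∫⁻ y in s ∩ t n, graphFactor u (fderiv ℝ f y) ∂(hyperMeasure u) := by
      conv_lhs => rw [hsu]
      exact lintegral_iUnion hm hdisj _
    have hM : μH[d] (graphMap u f '' s) = ∑' n, μH[d] (graphMap u f '' (s ∩ t n)) := by
      conv_lhs => rw [hsu]
      rw [image_iUnion, measure_iUnion]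
      · intro i j hij
        exact (disjoint_image_iff (graphMap_injective hu f)).2 (hdisj hij)
      · exact fun n => (measurableEmbedding_graphMap hu hf).measurableSet_image.2 (hm n)
    have hpow : (((1 + ε) ^ (2 * d) : ℝ≥0) : ℝ≥0∞) =
        (((1 + ε) ^ d : ℝ≥0) : ℝ≥0∞) * (((1 + ε) ^ d : ℝ≥0) : ℝ≥0∞) := by
      rw [← ENNReal.coe_mul]; congr 1; ring
    have hrpow : ((1 + ε : ℝ≥0) : ℝ≥0∞) ^ (d : ℝ) = (((1 + ε) ^ d : ℝ≥0) : ℝ≥0∞) := by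
      rw [ENNReal.rpow_natCast, ENNReal.coe_pow]
    have hclose : ∀ n, ∀ᵐ y ∂(hyperMeasure u).restrict (s ∩ t n),
        ‖fderiv ℝ f y - A n‖ ≤ ε := fun n =>
      norm_fderiv_sub_le_of_approximatesLinearOn _ (hm n) (ht n) fun x hx => hd x hx.1
    have hpiece : ∀ n, ∀ x ∈ s ∩ t n, ∀ y ∈ s ∩ t n,
        |(f x - f y) - (A n x - A n y)| ≤ ε * ‖x - y‖ := fun n x hx y hy => by
      have := ht n x hx y hy
      rwa [Real.norm_eq_abs, map_sub] at this
    rw [hI, hM, ← ENNReal.tsum_mul_left, ← ENNReal.tsum_mul_left]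
    constructor
    · refine ENNReal.tsum_le_tsum fun n => ?_
      refine (hausdorffMeasure_graph_le hu (hpiece n) (Nat.cast_nonneg _)).trans ?_
      rw [hausdorffMeasure_graphMap_clm hu, hrpow, hpow, mul_assoc]
      refine mul_le_mul_right ?_ _
      rw [← lintegral_const_mul' _ _ ENNReal.coe_ne_top, ← setLIntegral_const]
      refine lintegral_mono_ae ?_
      filter_upwards [hclose n] with y hy
      rw [← ENNReal.coe_mul, ENNReal.coe_le_coe]
      exact graphFactor_le_mul hu _ _ ((norm_sub_rev (A n) (fderiv ℝ f y)).le.trans hy)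
    · refine ENNReal.tsum_le_tsum fun n => ?_
      have h1 : ∫⁻ y in s ∩ t n, graphFactor u (fderiv ℝ f y) ∂(hyperMeasure u)
          ≤ (((1 + ε) ^ d : ℝ≥0) : ℝ≥0∞) * μH[d] (graphMap u (A n) '' (s ∩ t n)) := by
        rw [hausdorffMeasure_graphMap_clm hu, ← mul_assoc, ← setLIntegral_const]
        refine lintegral_mono_ae ?_
        filter_upwards [hclose n] with y hy
        rw [← ENNReal.coe_mul, ENNReal.coe_le_coe]
        exact graphFactor_le_mul hu _ _ hy
      refine h1.trans ?_
      rw [hpow, mul_assoc]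
      refine mul_le_mul_right ?_ _
      rw [← hrpow]
      refine hausdorffMeasure_graph_le hu (fun x hx y hy => ?_) (Nat.cast_nonneg _)
      rw [abs_sub_comm]
      exact hpiece n x hx y hy
  have hlim : ∀ a : ℝ≥0∞, Tendsto (fun ε : ℝ≥0 => (((1 + ε) ^ (2 * d) : ℝ≥0) : ℝ≥0∞) * a)
      (𝓝[>] 0) (𝓝 a) := fun a => by
    have h0 : Tendsto (fun ε : ℝ≥0 => (((1 + ε) ^ (2 * d) : ℝ≥0) : ℝ≥0∞)) (𝓝[>] 0) (𝓝 1) := by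
      rw [← ENNReal.coe_one, ENNReal.tendsto_coe]
      have : Continuous fun ε : ℝ≥0 => (1 + ε) ^ (2 * d) := by fun_prop
      simpa using (this.tendsto 0).mono_left nhdsWithin_le_nhds
    simpa using ENNReal.Tendsto.mul_const (b := a) h0 (Or.inl one_ne_zero)
  refine le_antisymm (ge_of_tendsto (hlim _) ?_) (ge_of_tendsto (hlim _) ?_)
  · filter_upwards [self_mem_nhdsWithin] with ε hε using (key ε hε).1
  · filter_upwards [self_mem_nhdsWithin] with ε hε using (key ε hε).2

/-- The graph of a Lipschitz function over the set of non-differentiability is negligible. -/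
theorem hausdorffMeasure_graphMap_not_differentiable {u : E} (hu : ‖u‖ = 1)
    {f : (Submodule.span ℝ {u})ᗮ → ℝ} {L : ℝ≥0} (hf : LipschitzWith L f) :
    μH[finrank ℝ (Submodule.span ℝ {u})ᗮ] (graphMap u f '' {y | ¬ DifferentiableAt ℝ f y}) = 0 := by
  refine le_antisymm (((lipschitz_graphMap hu hf).hausdorffMeasure_image_le
    (Nat.cast_nonneg _) _).trans ?_) zero_le
  have : hyperMeasure u {y | ¬ DifferentiableAt ℝ f y} = 0 :=
    hf.ae_differentiableAt (μ := hyperMeasure u)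
  change _ * hyperMeasure u _ ≤ 0
  rw [this, mul_zero]

/-- **Area formula** for the integral over a part of the graph of a Lipschitz function. -/
theorem lintegral_graphMap_image {u : E} (hu : ‖u‖ = 1)
    {f : (Submodule.span ℝ {u})ᗮ → ℝ} (hf : Continuous f)
    {s : Set (Submodule.span ℝ {u})ᗮ} (hs : MeasurableSet s)
    (hd : ∀ x ∈ s, DifferentiableAt ℝ f x) (g : E → ℝ≥0∞) (hg : Measurable g) :
    ∫⁻ x in graphMap u f '' s, g x ∂μH[finrank ℝ (Submodule.span ℝ {u})ᗮ]
      = ∫⁻ y in s, graphFactor u (fderiv ℝ f y) * g (graphMap u f y) ∂(hyperMeasure u) := by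
  have hJ : Measurable fun y => (graphFactor u (fderiv ℝ f y) : ℝ≥0∞) :=
    ((continuous_graphFactor hu).measurable.comp (measurable_fderiv ℝ f)).coe_nnreal_ennreal
  have hG := measurableEmbedding_graphMap hu hf
  have e : (μH[finrank ℝ (Submodule.span ℝ {u})ᗮ]).restrict (graphMap u f '' s) =
      Measure.map (graphMap u f)
        (((hyperMeasure u).restrict s).withDensity fun y => graphFactor u (fderiv ℝ f y)) := by
    ext t ht
    rw [Measure.restrict_apply ht, hG.map_apply, withDensity_apply _ (hG.measurable ht),
      Measure.restrict_restrict (hG.measurable ht), inter_comm, ← image_inter_preimage,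
      inter_comm (graphMap u f ⁻¹' t)]
    exact hausdorffMeasure_graphMap_of_differentiable hu hf (hs.inter (hG.measurable ht))
      fun x hx => hd x hx.1
  rw [e, lintegral_map hg hG.measurable]
  exact lintegral_withDensity_eq_lintegral_mul _ hJ (hg.comp hG.measurable)

end Area

/-! ### Derivatives of convex functions -/

variable {n : ℕ}

theorem _root_.ConvexOn.add_fderiv_le {V : Type*} [NormedAddCommGroup V] [NormedSpace ℝ V]
    {f : V → ℝ} (hf : ConvexOn ℝ univ f) {x : V} (hd : DifferentiableAt ℝ f x) (y : V) :
    f x + fderiv ℝ f x (y - x) ≤ f y := by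
  have h1 : ConvexOn ℝ univ (f ∘ (AffineMap.lineMap x y : ℝ →ᵃ[ℝ] V)) := by
    have := hf.comp_affineMap (AffineMap.lineMap x y : ℝ →ᵃ[ℝ] V)
    simpa using this
  have h2 : HasDerivAt (f ∘ (AffineMap.lineMap x y : ℝ →ᵃ[ℝ] V)) (fderiv ℝ f x (y - x)) (0 : ℝ) := by
    have h3 : HasDerivAt (AffineMap.lineMap x y : ℝ → V) (y - x) 0 := AffineMap.hasDerivAt_lineMap
    refine HasFDerivAt.comp_hasDerivAt (0 : ℝ) ?_ h3
    simpa using hd.hasFDerivAt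
  have := h1.le_slope_of_hasDerivAt (mem_univ 0) (mem_univ 1) one_pos h2
  simp only [slope_def_field, Function.comp_apply, AffineMap.lineMap_apply_zero,
    AffineMap.lineMap_apply_one, sub_zero, div_one] at this
  linarith

/-- Derivatives of pointwise convergent convex functions converge. -/
theorem tendsto_fderiv_of_convexOn {V : Type*} [NormedAddCommGroup V] [NormedSpace ℝ V]
    [FiniteDimensional ℝ V] {f : ℕ → V → ℝ} {f₀ : V → ℝ} (hf : ∀ i, ConvexOn ℝ univ (f i))
    (hlim : ∀ y, Tendsto (fun i => f i y) atTop (𝓝 (f₀ y))) {x : V}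
    (hd : ∀ i, DifferentiableAt ℝ (f i) x) (hd₀ : DifferentiableAt ℝ f₀ x) :
    Tendsto (fun i => fderiv ℝ (f i) x) atTop (𝓝 (fderiv ℝ f₀ x)) := by
  -- By convexity a forward difference quotient bounds the derivative from above. Choose the step
  -- `s` for `f₀` first; with `s` fixed, the quotients of `f i` converge. Lower bounds follow by
  -- applying this to `-w`.
  have hup : ∀ (w : V) (c : ℝ), fderiv ℝ f₀ x w < c → ∀ᶠ i in atTop, fderiv ℝ (f i) x w < c := by
    intro w c hc
    have hl : HasDerivAt (fun s : ℝ => f₀ (x + s • w)) (fderiv ℝ f₀ x w) 0 := by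
      have h3 : HasDerivAt (fun s : ℝ => x + s • w) w 0 := by
        simpa using ((hasDerivAt_id (0 : ℝ)).smul_const w).const_add x
      refine HasFDerivAt.comp_hasDerivAt (0 : ℝ) ?_ h3
      simpa using hd₀.hasFDerivAt
    have h4 := (hasDerivAt_iff_tendsto_slope_zero.1 hl).mono_left
      (nhdsWithin_mono 0 (fun s (hs : s ∈ Ioi (0 : ℝ)) => ne_of_gt hs))
    obtain ⟨s, hs, hs0⟩ := ((h4.eventually (gt_mem_nhds hc)).and self_mem_nhdsWithin).exists
    have hs0 : 0 < s := hs0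
    have h5 : Tendsto (fun i => s⁻¹ * (f i (x + s • w) - f i x)) atTop
        (𝓝 (s⁻¹ * (f₀ (x + s • w) - f₀ x))) := ((hlim _).sub (hlim _)).const_mul _
    have hs : s⁻¹ * (f₀ (x + s • w) - f₀ x) < c := by simpa using hs
    filter_upwards [h5.eventually (gt_mem_nhds hs)] with i hi
    refine lt_of_le_of_lt ?_ hi
    have := (hf i).add_fderiv_le (hd i) (x + s • w)
    rw [add_sub_cancel_left, map_smul, smul_eq_mul] at this
    rw [le_inv_mul_iff₀ hs0]
    linarith
  have hpt : ∀ w, Tendsto (fun i => fderiv ℝ (f i) x w) atTop (𝓝 (fderiv ℝ f₀ x w)) := by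
    intro w
    refine tendsto_order.2 ⟨fun c hc => ?_, fun c hc => hup w c hc⟩
    filter_upwards [hup (-w) (-c) (by simpa using hc)] with i hi
    simpa using hi
  -- Values on a basis determine a functional continuously, so pointwise convergence gives
  -- convergence in norm.
  let b := finBasis ℝ V
  let e : (V →L[ℝ] ℝ) ≃ₗ[ℝ] (Fin (finrank ℝ V) → ℝ) :=
    LinearMap.toContinuousLinearMap.symm.trans (b.constr ℝ).symm
  have he : Continuous e.symm := LinearMap.continuous_of_finiteDimensional e.symm.toLinearMap
  have hea : ∀ A i, e A i = A (b i) := fun A i => by simp [e, Basis.constr]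
  have h6 : Tendsto (fun i => e (fderiv ℝ (f i) x)) atTop (𝓝 (e (fderiv ℝ f₀ x))) := by
    refine tendsto_pi_nhds.2 fun j => ?_
    simp only [hea]
    exact hpt _
  simpa [Function.comp_def] using (he.tendsto _).comp h6

/-! ### The normal vector of a graph -/

section Normal

variable {E : Type*} [NormedAddCommGroup E] [InnerProductSpace ℝ E]

/-- The projection to `u^⊥`. -/
def hyperProj (u : E) : E →L[ℝ] (Submodule.span ℝ {u})ᗮ := 
  (Submodule.span ℝ {u})ᗮ.orthogonalProjectionOnto

theorem hyperProj_add_inner_smul {u : E} (hu : ‖u‖ = 1) (x : E) :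
    (hyperProj u x : E) + (inner ℝ x u : ℝ) • u = x := by
  have h := Submodule.starProjection_add_starProjection_orthogonal (K := Submodule.span ℝ {u}) x
  rw [Submodule.starProjection_unit_singleton ℝ hu, add_comm, real_inner_comm] at h
  exact h

variable [FiniteDimensional ℝ E]

/-- The unit vector outer normal to the epigraph of a function with derivative `A`. -/
def normalDir (u : E) (A : (Submodule.span ℝ {u})ᗮ →L[ℝ] ℝ) : E :=
  ‖(((InnerProductSpace.toDual ℝ _).symm A : (Submodule.span ℝ {u})ᗮ) : E) - u‖⁻¹ •
    ((((InnerProductSpace.toDual ℝ _).symm A : (Submodule.span ℝ {u})ᗮ) : E) - u)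

theorem inner_sub_toDual_symm {u : E} (hu : ‖u‖ = 1) (A : (Submodule.span ℝ {u})ᗮ →L[ℝ] ℝ)
    (y : (Submodule.span ℝ {u})ᗮ) (t : ℝ) :
    inner ℝ ((y : E) + t • u)
      ((((InnerProductSpace.toDual ℝ _).symm A : (Submodule.span ℝ {u})ᗮ) : E) - u) = A y - t := by
  have h1 : inner ℝ (y : E) (((InnerProductSpace.toDual ℝ _).symm A : (Submodule.span ℝ {u})ᗮ) : E)
      = A y := by
    rw [← Submodule.coe_inner, real_inner_comm, InnerProductSpace.toDual_symm_apply]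
  have h2 : inner ℝ u (((InnerProductSpace.toDual ℝ _).symm A : (Submodule.span ℝ {u})ᗮ) : E) = 0 := by
    rw [real_inner_comm, inner_coe_orthogonal]
  rw [inner_add_left, inner_sub_right, inner_sub_right, inner_smul_left, inner_smul_left, h1, h2,
    inner_coe_orthogonal, real_inner_self_eq_norm_sq, hu]
  simp [sub_eq_add_neg]

theorem toDual_symm_sub_ne_zero {u : E} (hu : ‖u‖ = 1) (A : (Submodule.span ℝ {u})ᗮ →L[ℝ] ℝ) :
    ‖(((InnerProductSpace.toDual ℝ _).symm A : (Submodule.span ℝ {u})ᗮ) : E) - u‖ ≠ 0 := by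
  intro h
  have := inner_sub_toDual_symm hu A 0 1
  rw [norm_eq_zero.1 h] at this
  simp at this

theorem inner_normalDir {u : E} (hu : ‖u‖ = 1) (A : (Submodule.span ℝ {u})ᗮ →L[ℝ] ℝ)
    (y : (Submodule.span ℝ {u})ᗮ) (t : ℝ) :
    inner ℝ ((y : E) + t • u) (normalDir u A) =
      ‖(((InnerProductSpace.toDual ℝ _).symm A : (Submodule.span ℝ {u})ᗮ) : E) - u‖⁻¹ *
        (A y - t) := by
  rw [normalDir, inner_smul_right, inner_sub_toDual_symm hu]

theorem continuous_normalDir {u : E} (hu : ‖u‖ = 1) : Continuous (normalDir u) := by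
  unfold normalDir
  have h : Continuous fun A : (Submodule.span ℝ {u})ᗮ →L[ℝ] ℝ =>
      (((InnerProductSpace.toDual ℝ _).symm A : (Submodule.span ℝ {u})ᗮ) : E) - u :=
    (continuous_subtype_val.comp
      (InnerProductSpace.toDual ℝ (Submodule.span ℝ {u})ᗮ).symm.continuous).sub continuous_const
  exact (h.norm.inv₀ fun A => toDual_symm_sub_ne_zero hu A).smul h

/-- At a point of differentiability, `normalDir` is the only unit outer normal of the epigraph. -/
theorem eq_normalDir {u : E} (hu : ‖u‖ = 1) {f : (Submodule.span ℝ {u})ᗮ → ℝ}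
    {y : (Submodule.span ℝ {u})ᗮ} (hd : DifferentiableAt ℝ f y) {v : E} (hv : ‖v‖ = 1)
    (huv : inner ℝ u v < 0)
    (hmax : ∀ z, inner ℝ (graphMap u f z) v ≤ inner ℝ (graphMap u f y) v) :
    v = normalDir u (fderiv ℝ f y) := by
  have hg : ∀ z, inner ℝ (graphMap u f z) v = inner ℝ v (z : E) + f z * inner ℝ u v := fun z => by
    rw [graphMap, inner_add_left, inner_smul_left, real_inner_comm]; simp
  have hder : HasFDerivAt (fun z => inner ℝ (graphMap u f z) v)
      ((innerSL ℝ v).comp (Submodule.span ℝ {u})ᗮ.subtypeL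
        + (inner ℝ u v : ℝ) • fderiv ℝ f y) y := by
    simp only [hg]
    exact ((innerSL ℝ v).comp (Submodule.span ℝ {u})ᗮ.subtypeL).hasFDerivAt.add
      (hd.hasFDerivAt.mul_const _)
  have hmax' : IsLocalMax (fun z => inner ℝ (graphMap u f z) v) y := Eventually.of_forall hmax
  have h0 := hmax'.hasFDerivAt_eq_zero hder
  have hw : ∀ w : (Submodule.span ℝ {u})ᗮ,
      inner ℝ (w : E) v + inner ℝ u v * fderiv ℝ f y w = 0 := fun w => by
    have := congrArg (fun A : (Submodule.span ℝ {u})ᗮ →L[ℝ] ℝ => A w) h0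
    rw [real_inner_comm]
    simpa using this
  set a := ((((InnerProductSpace.toDual ℝ _).symm (fderiv ℝ f y) : (Submodule.span ℝ {u})ᗮ) : E) - u)
    with ha
  have hva : v = (-inner ℝ u v : ℝ) • a := by
    refine ext_inner_left ℝ fun x => ?_
    rw [← hyperProj_add_inner_smul hu x, inner_smul_right, ha, inner_sub_toDual_symm hu,
      inner_add_left, inner_smul_left]
    have := hw (hyperProj u x)
    simp only [conj_trivial]
    linarith
  -- The vanishing derivative fixes `v` up to a positive scale, and `‖v‖ = 1` fixes the scale.
  have hn : (-inner ℝ u v : ℝ) * ‖a‖ = 1 := by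
    have := congrArg norm hva
    rw [hv, norm_smul, Real.norm_of_nonneg (by linarith)] at this
    exact this.symm
  have hu' : (-inner ℝ u v : ℝ) = ‖a‖⁻¹ := eq_inv_of_mul_eq_one_left hn
  rw [hu'] at hva
  exact hva

end Normal

/-! ### Pseudo-cones as epigraphs of Lipschitz convex functions -/

/-- The function on `u^⊥` whose epigraph in direction `u` is `K`. -/
def heightFun (u : EuclideanSpace ℝ (Fin n)) (K : Set (EuclideanSpace ℝ (Fin n)))
    (y : (Submodule.span ℝ {u})ᗮ) : ℝ :=
  sInf {t : ℝ | (y : EuclideanSpace ℝ (Fin n)) + t • u ∈ K}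

/-- A standing configuration: a unit vector `u` whose ball of radius `r` lies in the cone `C`, while
`C` lies in the half-space of nonnegative inner product with `u`. -/
structure ConeFrame (C : ProperCone ℝ (EuclideanSpace ℝ (Fin n))) (u : EuclideanSpace ℝ (Fin n))
    (r : ℝ) : Prop where
  norm_eq : ‖u‖ = 1
  pos : 0 < r
  ball_subset : ∀ x, ‖x - u‖ ≤ r → x ∈ C
  inner_nonneg : ∀ x ∈ C, 0 ≤ inner ℝ x u

section Frame

variable {C : ProperCone ℝ (EuclideanSpace ℝ (Fin n))} {u : EuclideanSpace ℝ (Fin n)} {r : ℝ}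
  {K : Set (EuclideanSpace ℝ (Fin n))}

theorem IsPseudoCone.add_mem {C K : Set (EuclideanSpace ℝ (Fin n))} (hK : IsPseudoCone C K)
    {x c : EuclideanSpace ℝ (Fin n)} (hx : x ∈ K) (hc : c ∈ C) : x + c ∈ K := by
  rw [← hK.recCone_eq] at hc
  exact hc x hx

namespace ConeFrame

variable (F : ConeFrame C u r)
include F

theorem add_smul_mem {w : EuclideanSpace ℝ (Fin n)} {t : ℝ} (h : ‖w‖ ≤ r * t) : w + t • u ∈ C := by
  have ht : 0 ≤ t := by
    by_contra ht
    have := F.pos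
    have := norm_nonneg w
    nlinarith
  rcases ht.eq_or_lt with rfl | ht
  · have : w = 0 := by simpa using h
    simp [this]
  · have : w + t • u = t • (t⁻¹ • w + u) := by
      rw [smul_add, smul_smul, mul_inv_cancel₀ ht.ne', one_smul]
    rw [this]
    refine C.smul_mem (F.ball_subset _ ?_) ht.le
    rw [add_sub_cancel_right, norm_smul, norm_inv, Real.norm_of_nonneg ht.le,
      inv_mul_le_iff₀ ht, mul_comm]
    exact h

theorem inner_coe_add_smul (y : (Submodule.span ℝ {u})ᗮ) (t : ℝ) :
    inner ℝ ((y : EuclideanSpace ℝ (Fin n)) + t • u) u = t := by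
  rw [inner_add_left, inner_coe_orthogonal, inner_smul_left, real_inner_self_eq_norm_sq, F.norm_eq]
  simp

/-- Each line in direction `u` meets `K` in a closed upward half-line: nonempty because a point of
`K` plus the cone about `u` reaches every line, bounded below because `⟨x, u⟩ ≥ 0` on `C`, and
upward closed because `u ∈ C`. Hence the infimum in `heightFun` is attained. -/
theorem add_smul_mem_iff (hK : IsPseudoCone C K) (y : (Submodule.span ℝ {u})ᗮ) (t : ℝ) :
    (y : EuclideanSpace ℝ (Fin n)) + t • u ∈ K ↔ heightFun u K y ≤ t := by
  set S := {t : ℝ | (y : EuclideanSpace ℝ (Fin n)) + t • u ∈ K}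
  have hcl : IsClosed S := hK.isClosed.preimage (by fun_prop)
  have hb : BddBelow S := ⟨0, fun s hs => by
    have := F.inner_nonneg _ (hK.subset hs)
    rwa [F.inner_coe_add_smul] at this⟩
  have hne : S.Nonempty := by
    obtain ⟨x, hx⟩ := hK.nonempty
    refine ⟨r⁻¹ * ‖(y : EuclideanSpace ℝ (Fin n)) - x‖, ?_⟩
    have := hK.add_mem hx (F.add_smul_mem (w := (y : EuclideanSpace ℝ (Fin n)) - x)
      (t := r⁻¹ * ‖(y : EuclideanSpace ℝ (Fin n)) - x‖) (by
        rw [← mul_assoc, mul_inv_cancel₀ F.pos.ne', one_mul]))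
    rw [← add_assoc, add_sub_cancel] at this
    exact this
  constructor
  · exact fun h => csInf_le hb h
  · intro h
    have h1 : (y : EuclideanSpace ℝ (Fin n)) + heightFun u K y • u ∈ K := hcl.csInf_mem hne hb
    have h2 := hK.add_mem h1 (c := (t - heightFun u K y) • u) (by
      have := F.add_smul_mem (w := 0) (t := t - heightFun u K y) (by
        rw [norm_zero]; exact mul_nonneg F.pos.le (sub_nonneg.2 h))
      simpa using this)
    rwa [add_assoc, ← add_smul, add_sub_cancel] at h2

theorem mem_iff (hK : IsPseudoCone C K) (x : EuclideanSpace ℝ (Fin n)) :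
    x ∈ K ↔ heightFun u K (hyperProj u x) ≤ inner ℝ x u := by
  rw [← F.add_smul_mem_iff hK, hyperProj_add_inner_smul F.norm_eq]

theorem graphMap_mem (hK : IsPseudoCone C K) (y : (Submodule.span ℝ {u})ᗮ) :
    graphMap u (heightFun u K) y ∈ K := (F.add_smul_mem_iff hK y _).2 le_rfl

/-- `K` contains the circular cone with apex `x`, axis `u` and slope `r⁻¹`. The Lipschitz bound is
the case where `x` is a graph point. -/
theorem heightFun_le_add (hK : IsPseudoCone C K) {x : EuclideanSpace ℝ (Fin n)} (hx : x ∈ K)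
    (y : (Submodule.span ℝ {u})ᗮ) :
    heightFun u K y ≤ inner ℝ x u + r⁻¹ * ‖y - hyperProj u x‖ := by
  rw [← F.add_smul_mem_iff hK]
  have := hK.add_mem hx (F.add_smul_mem (w := ((y - hyperProj u x : (Submodule.span ℝ {u})ᗮ) :
    EuclideanSpace ℝ (Fin n))) (t := r⁻¹ * ‖y - hyperProj u x‖) (by
        rw [← mul_assoc, mul_inv_cancel₀ F.pos.ne', one_mul]; rfl))
  convert this using 1
  nth_rewrite 3 [← hyperProj_add_inner_smul F.norm_eq x]
  rw [Submodule.coe_sub, add_smul]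
  abel

theorem hyperProj_graph (y : (Submodule.span ℝ {u})ᗮ) (t : ℝ) :
    hyperProj u ((y : EuclideanSpace ℝ (Fin n)) + t • u) = y := by
  have h := hyperProj_add_inner_smul F.norm_eq ((y : EuclideanSpace ℝ (Fin n)) + t • u)
  rw [F.inner_coe_add_smul] at h
  exact Subtype.ext (add_right_cancel h)

theorem lipschitz_heightFun (hK : IsPseudoCone C K) :
    LipschitzWith ⟨r⁻¹, inv_nonneg.2 F.pos.le⟩ (heightFun u K) := by
  refine LipschitzWith.of_le_add_mul _ fun x y => ?_
  have := F.heightFun_le_add hK (F.graphMap_mem hK y) x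
  rw [graphMap, F.hyperProj_graph, F.inner_coe_add_smul] at this
  rw [dist_eq_norm]
  exact this

theorem continuous_heightFun (hK : IsPseudoCone C K) : Continuous (heightFun u K) :=
  (F.lipschitz_heightFun hK).continuous

theorem convexOn_heightFun (hK : IsPseudoCone C K) : ConvexOn ℝ univ (heightFun u K) := by
  refine ⟨convex_univ, fun x _ y _ a b ha hb hab => ?_⟩
  rw [← F.add_smul_mem_iff hK]
  have := hK.convex (F.graphMap_mem hK x) (F.graphMap_mem hK y) ha hb hab
  convert this using 1
  simp only [graphMap, Submodule.coe_add, Submodule.coe_smul, smul_add, smul_smul, smul_eq_mul,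
    add_smul]
  abel

theorem frontier_eq (hK : IsPseudoCone C K) : frontier K = range (graphMap u (heightFun u K)) := by
  have hc := F.continuous_heightFun hK
  ext x
  constructor
  · intro hx
    have hxK : x ∈ K := hK.isClosed.frontier_subset hx
    refine ⟨hyperProj u x, ?_⟩
    have hle := (F.mem_iff hK x).1 hxK
    rcases hle.eq_or_lt with h | h
    · rw [graphMap, h, hyperProj_add_inner_smul F.norm_eq]
    · exfalso
      have hopen : IsOpen {x : EuclideanSpace ℝ (Fin n) |
          heightFun u K (hyperProj u x) < inner ℝ x u} :=
        isOpen_lt (hc.comp (hyperProj u).continuous) (by fun_prop)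
      exact hx.2 (mem_interior.2 ⟨_, fun z (hz : _ < _) => (F.mem_iff hK z).2 hz.le, hopen, h⟩)
  · rintro ⟨y, rfl⟩
    refine ⟨subset_closure (F.graphMap_mem hK y), fun hint => ?_⟩
    have ht : Tendsto (fun t : ℝ => (y : EuclideanSpace ℝ (Fin n)) + t • u)
        (𝓝[<] (heightFun u K y)) (𝓝 (graphMap u (heightFun u K) y)) := by
      have : Continuous fun t : ℝ => (y : EuclideanSpace ℝ (Fin n)) + t • u := by fun_prop
      exact (this.tendsto _).mono_left nhdsWithin_le_nhds
    obtain ⟨t, h1, h2⟩ := ((ht.eventually (mem_interior_iff_mem_nhds.1 hint)).and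
      self_mem_nhdsWithin).exists
    exact absurd ((F.add_smul_mem_iff hK y t).1 h1) (not_le.2 h2)

/-- The point `u + r v / ‖v‖` still lies in `C`; pairing it with `v` gives `⟨u, v⟩ ≤ -r ‖v‖`. -/
theorem inner_neg_of_mem_polarCone {v : EuclideanSpace ℝ (Fin n)} (hv : v ∈ polarCone (C : Set (EuclideanSpace ℝ (Fin n))))
    (h0 : v ≠ 0) : inner ℝ u v < 0 := by
  have hn : 0 < ‖v‖ := norm_pos_iff.2 h0
  have h1 := hv _ (F.add_smul_mem (w := r • ‖v‖⁻¹ • v) (t := 1) (by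
    rw [norm_smul, norm_smul, norm_inv, norm_norm, inv_mul_cancel₀ hn.ne',
      Real.norm_of_nonneg F.pos.le]))
  rw [inner_add_right, inner_smul_right, inner_smul_right, real_inner_self_eq_norm_sq, one_smul,
    real_inner_comm] at h1
  have : r * (‖v‖⁻¹ * ‖v‖ ^ 2) = r * ‖v‖ := by field_simp
  have := mul_pos F.pos hn
  linarith

theorem inner_normalDir_le (hK : IsPseudoCone C K) {y : (Submodule.span ℝ {u})ᗮ}
    (hd : DifferentiableAt ℝ (heightFun u K) y) {x : EuclideanSpace ℝ (Fin n)} (hx : x ∈ K) :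
    inner ℝ x (normalDir u (fderiv ℝ (heightFun u K) y)) ≤
      inner ℝ (graphMap u (heightFun u K) y) (normalDir u (fderiv ℝ (heightFun u K) y)) := by
  rw [graphMap, inner_normalDir F.norm_eq]
  nth_rewrite 1 [← hyperProj_add_inner_smul F.norm_eq x]
  rw [inner_normalDir F.norm_eq]
  refine mul_le_mul_of_nonneg_left ?_ (inv_nonneg.2 (norm_nonneg _))
  have h1 := (F.mem_iff hK x).1 hx
  have h2 := (F.convexOn_heightFun hK).add_fderiv_le hd (hyperProj u x)
  rw [map_sub] at h2
  linarith

end ConeFrame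

/-! ### Support functions, normals of determined sets, and Schneider convergence -/

theorem bddAbove_inner_image (hK : IsPseudoCone (C : Set (EuclideanSpace ℝ (Fin n))) K)
    {v : EuclideanSpace ℝ (Fin n)} (hv : v ∈ polarCone (C : Set (EuclideanSpace ℝ (Fin n)))) :
    BddAbove ((fun x => (inner ℝ x v : ℝ)) '' K) := by
  refine ⟨0, ?_⟩
  rintro _ ⟨x, hx, rfl⟩
  have := hv x (hK.subset hx)
  rwa [real_inner_comm] at this

theorem inner_le_supportFun (hK : IsPseudoCone (C : Set (EuclideanSpace ℝ (Fin n))) K)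
    {v : EuclideanSpace ℝ (Fin n)} (hv : v ∈ polarCone (C : Set (EuclideanSpace ℝ (Fin n))))
    {x : EuclideanSpace ℝ (Fin n)} (hx : x ∈ K) : inner ℝ x v ≤ supportFun K v :=
  le_csSup (bddAbove_inner_image hK hv) ⟨x, hx, rfl⟩

theorem mem_polarCone_of_mem_sphInterior {C : Set (EuclideanSpace ℝ (Fin n))}
    {v : EuclideanSpace ℝ (Fin n)} (hv : v ∈ sphInterior (polarCone C)) : v ∈ polarCone C :=
  interior_subset hv.1

theorem norm_eq_of_mem_sphInterior {C : Set (EuclideanSpace ℝ (Fin n))}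
    {v : EuclideanSpace ℝ (Fin n)} (hv : v ∈ sphInterior C) : ‖v‖ = 1 := by
  simpa using hv.2

/-- A vector of the cone that is orthogonal to an interior vector of the polar cone vanishes. -/
theorem eq_zero_of_inner_eq_zero {C : Set (EuclideanSpace ℝ (Fin n))}
    {v x : EuclideanSpace ℝ (Fin n)} (hv : v ∈ interior (polarCone C)) (hx : x ∈ C)
    (h : inner ℝ x v = 0) : x = 0 := by
  -- For small `t > 0` the vector `v + t • x` is still polar, and pairing it with `x` leaves `t ‖x‖²
  -- ≤ 0`.
  have ht : Tendsto (fun t : ℝ => v + t • x) (𝓝[>] 0) (𝓝 v) := by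
    have : Continuous fun t : ℝ => v + t • x := by fun_prop
    simpa using (this.tendsto 0).mono_left nhdsWithin_le_nhds
  obtain ⟨t, h1, h2⟩ := ((ht.eventually (mem_interior_iff_mem_nhds.1 hv)).and
    self_mem_nhdsWithin).exists
  have h2 : 0 < t := h2
  have h3 := h1 x hx
  rw [inner_add_left, real_inner_comm, h, inner_smul_left, real_inner_self_eq_norm_sq, zero_add,
    conj_trivial] at h3
  have h4 : ‖x‖ ^ 2 ≤ 0 := nonpos_of_mul_nonpos_right h3 h2
  have h5 : ‖x‖ ^ 2 = 0 := le_antisymm h4 (sq_nonneg _)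
  exact norm_eq_zero.1 (pow_eq_zero_iff two_ne_zero |>.1 h5)

/-- A supporting functional of `C` at `x` takes the value `0` there, as comparison with `0` and `2 •
x` shows, so it is nonpositive on all of `C`; normalize it. -/
theorem exists_polar_of_notMem_interior (hC : (interior (C : Set (EuclideanSpace ℝ (Fin n)))).Nonempty)
    {x : EuclideanSpace ℝ (Fin n)} (hx : x ∈ C) (hx' : x ∉ interior (C : Set (EuclideanSpace ℝ (Fin n)))) :
    ∃ v ∈ polarCone (C : Set (EuclideanSpace ℝ (Fin n))), ‖v‖ = 1 ∧ inner ℝ x v = 0 := by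
  obtain ⟨g, hg⟩ := geometric_hahn_banach_open_point C.convex.interior isOpen_interior hx'
  have hle : ∀ a ∈ C, g a ≤ g x := by
    intro a ha
    have hcl : a ∈ closure (interior (C : Set (EuclideanSpace ℝ (Fin n)))) := by
      rw [C.convex.closure_interior_eq_closure_of_nonempty_interior hC]
      exact subset_closure ha
    exact closure_minimal (fun b hb => (hg b hb).le) (isClosed_le g.continuous continuous_const) hcl
  have h0 : g x = 0 := by
    have h1 := hle 0 C.zero_mem
    have h2 := hle _ (C.smul_mem hx zero_le_two)
    rw [map_zero] at h1
    rw [map_smul, smul_eq_mul] at h2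
    linarith
  obtain ⟨a, ha⟩ := hC
  have hgne : g ≠ 0 := by
    rintro rfl
    simpa using hg a ha
  set w := (InnerProductSpace.toDual ℝ _).symm g with hw
  have hwg : ∀ y, inner ℝ w y = g y := fun y => InnerProductSpace.toDual_symm_apply
  have hwne : ‖w‖ ≠ 0 := by
    rw [hw, LinearIsometryEquiv.norm_map]; exact norm_ne_zero_iff.2 hgne
  refine ⟨‖w‖⁻¹ • w, fun y hy => ?_, ?_, ?_⟩
  · rw [inner_smul_left, hwg]
    exact mul_nonpos_of_nonneg_of_nonpos (by simp) ((hle y hy).trans h0.le)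
  · rw [norm_smul, norm_inv, norm_norm, inv_mul_cancel₀ hwne]
  · rw [inner_smul_right, real_inner_comm, hwg, h0, mul_zero]

namespace ConeFrame

variable (F : ConeFrame C u r)
include F

theorem eq_normalDir_of_inner_max (hK : IsPseudoCone (C : Set (EuclideanSpace ℝ (Fin n))) K)
    {y : (Submodule.span ℝ {u})ᗮ} (hd : DifferentiableAt ℝ (heightFun u K) y)
    {v : EuclideanSpace ℝ (Fin n)} (hv : v ∈ polarCone (C : Set (EuclideanSpace ℝ (Fin n))))
    (hv1 : ‖v‖ = 1)
    (hmax : ∀ x ∈ K, inner ℝ x v ≤ inner ℝ (graphMap u (heightFun u K) y) v) :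
    v = normalDir u (fderiv ℝ (heightFun u K) y) :=
  eq_normalDir F.norm_eq hd hv1
    (F.inner_neg_of_mem_polarCone hv (norm_ne_zero_iff.1 (by rw [hv1]; exact one_ne_zero)))
    fun z => hmax _ (F.graphMap_mem hK z)

theorem exists_mem_iff_normalDir_mem (hK : IsPseudoCone (C : Set (EuclideanSpace ℝ (Fin n))) K)
    {y : (Submodule.span ℝ {u})ᗮ} (hd : DifferentiableAt ℝ (heightFun u K) y)
    {B : Set (EuclideanSpace ℝ (Fin n))}
    (hB : B ⊆ sphInterior (polarCone (C : Set (EuclideanSpace ℝ (Fin n))))) :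
    (∃ v ∈ B, inner ℝ (graphMap u (heightFun u K) y) v = supportFun K v) ↔
      normalDir u (fderiv ℝ (heightFun u K) y) ∈ B := by
  constructor
  · rintro ⟨v, hvB, hv⟩
    have hp := mem_polarCone_of_mem_sphInterior (hB hvB)
    rw [← F.eq_normalDir_of_inner_max hK hd hp (norm_eq_of_mem_sphInterior (hB hvB)) fun x hx => by
      rw [hv]; exact inner_le_supportFun hK hp hx]
    exact hvB
  · intro h
    refine ⟨_, h, le_antisymm (inner_le_supportFun hK (mem_polarCone_of_mem_sphInterior (hB h))
      (F.graphMap_mem hK y)) ?_⟩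
    refine csSup_le (hK.nonempty.image _) ?_
    rintro _ ⟨x, hx, rfl⟩
    exact F.inner_normalDir_le hK hd hx

/-- The outer normals of a `C`-determined set at boundary points interior to `C` lie in `ω`. -/
theorem normalDir_mem {ω : Set (EuclideanSpace ℝ (Fin n))} (hω : IsCompact ω)
    (hω_sub : ω ⊆ sphInterior (polarCone (C : Set (EuclideanSpace ℝ (Fin n)))))
    (hK : IsDetermined (C : Set (EuclideanSpace ℝ (Fin n))) ω K)
    {y : (Submodule.span ℝ {u})ᗮ} (hd : DifferentiableAt ℝ (heightFun u K) y)
    (hy : graphMap u (heightFun u K) y ∈ interior (C : Set (EuclideanSpace ℝ (Fin n)))) :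
    normalDir u (fderiv ℝ (heightFun u K) y) ∈ ω := by
  have hP := hK.isPseudoCone
  rw [← F.exists_mem_iff_normalDir_mem hP hd hω_sub]
  by_contra! hcon
  have hlt : ∀ v ∈ ω, ∃ z ∈ K,
      inner ℝ (graphMap u (heightFun u K) y) v < inner ℝ z v := by
    intro v hv
    have hp := mem_polarCone_of_mem_sphInterior (hω_sub hv)
    have h1 := lt_of_le_of_ne (inner_le_supportFun hP hp (F.graphMap_mem hP y)) (hcon v hv)
    obtain ⟨_, ⟨z, hz, rfl⟩, h2⟩ := exists_lt_of_lt_csSup (hP.nonempty.image _) h1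
    exact ⟨z, hz, h2⟩
  -- If no `v ∈ ω` is a normal at the graph point, every constraint is strict there. Compactness of
  -- `ω` keeps them all strict nearby, so the point would be interior to `K`.
  have hev : ∀ᶠ x in 𝓝 (graphMap u (heightFun u K) y), ∀ v ∈ ω, ∃ z ∈ K,
      inner ℝ x v < inner ℝ z v := by
    refine hω.eventually_forall_of_forall_eventually fun v hv => ?_
    obtain ⟨z, hz, h⟩ := hlt v hv
    have hopen : IsOpen {p : (EuclideanSpace ℝ (Fin n)) × EuclideanSpace ℝ (Fin n) |
        inner ℝ p.1 p.2 < inner ℝ z p.2} := isOpen_lt (by fun_prop) (by fun_prop)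
    filter_upwards [hopen.mem_nhds h] with p hp using ⟨z, hz, hp⟩
  have hnhds : K ∈ 𝓝 (graphMap u (heightFun u K) y) := by
    filter_upwards [hev, mem_interior_iff_mem_nhds.1 hy] with x hx hxC
    rw [hK.eq_inter]
    refine ⟨hxC, mem_iInter₂.2 fun v hv => ?_⟩
    obtain ⟨z, hz, h⟩ := hx v hv
    exact h.le.trans (inner_le_supportFun hP (mem_polarCone_of_mem_sphInterior (hω_sub hv)) hz)
  have hfr : graphMap u (heightFun u K) y ∈ frontier K := by
    rw [F.frontier_eq hP]; exact mem_range_self y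
  exact hfr.2 (mem_interior_iff_mem_nhds.2 hnhds)

/-- At a differentiability point where the graph touches the boundary of the cone, the normal is not
interior to the polar cone. -/
theorem normalDir_notMem (hC : (interior (C : Set (EuclideanSpace ℝ (Fin n)))).Nonempty)
    (hK : IsPseudoCone (C : Set (EuclideanSpace ℝ (Fin n))) K)
    {y : (Submodule.span ℝ {u})ᗮ} (hd : DifferentiableAt ℝ (heightFun u K) y)
    (hy : graphMap u (heightFun u K) y ∉ interior (C : Set (EuclideanSpace ℝ (Fin n)))) :
    normalDir u (fderiv ℝ (heightFun u K) y) ∉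
      sphInterior (polarCone (C : Set (EuclideanSpace ℝ (Fin n)))) := by
  intro hmem
  have hGK := F.graphMap_mem hK y
  obtain ⟨v, hv, hv1, hv0⟩ := exists_polar_of_notMem_interior hC (hK.subset hGK) hy
  -- A normal of `C` at the graph point is also a normal of `K ⊆ C`, hence the only one. Were it
  -- interior to the polar cone, its orthogonality to the graph point would force that point to be
  -- `0`.
  have := F.eq_normalDir_of_inner_max hK hd hv hv1 fun x hx => by
    rw [hv0, real_inner_comm]
    exact hv x (hK.subset hx)
  rw [← this] at hmem
  have h0 := eq_zero_of_inner_eq_zero hmem.1 (hK.subset hGK) hv0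
  rw [h0] at hGK
  exact hK.zero_notMem hGK

theorem heightFun_le_add_dist (hK : IsPseudoCone (C : Set (EuclideanSpace ℝ (Fin n))) K)
    {x p : EuclideanSpace ℝ (Fin n)} (hx : x ∈ K) :
    heightFun u K (hyperProj u p) ≤ inner ℝ p u + (1 + r⁻¹) * dist p x := by
  have h1 := F.heightFun_le_add hK hx (hyperProj u p)
  have h2 : p - x = ((hyperProj u p - hyperProj u x : (Submodule.span ℝ {u})ᗮ) :
      EuclideanSpace ℝ (Fin n)) + (inner ℝ p u - inner ℝ x u : ℝ) • u := by
    nth_rewrite 1 [← hyperProj_add_inner_smul F.norm_eq x, ← hyperProj_add_inner_smul F.norm_eq p]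
    rw [Submodule.coe_sub, sub_smul]; abel
  have h3 := norm_le_norm_coe_add_smul F.norm_eq (hyperProj u p - hyperProj u x)
    (inner ℝ p u - inner ℝ x u)
  have h4 := abs_le_norm_coe_add_smul F.norm_eq (hyperProj u p - hyperProj u x)
    (inner ℝ p u - inner ℝ x u)
  rw [← h2, ← dist_eq_norm p x] at h3 h4
  have h5 := mul_le_mul_of_nonneg_left h3 (inv_nonneg.2 F.pos.le)
  have h6 := (abs_le.1 h4).1
  rw [add_mul, one_mul]
  linarith

/-- Schneider convergence implies pointwise convergence of the height functions. -/
theorem tendsto_heightFun {K : ℕ → Set (EuclideanSpace ℝ (Fin n))}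
    {K₀ : Set (EuclideanSpace ℝ (Fin n))}
    (hK : ∀ i, IsPseudoCone (C : Set (EuclideanSpace ℝ (Fin n))) (K i))
    (hK₀ : IsPseudoCone (C : Set (EuclideanSpace ℝ (Fin n))) K₀)
    (hconv : SchneiderTendsto (C : Set (EuclideanSpace ℝ (Fin n))) u K K₀)
    (y : (Submodule.span ℝ {u})ᗮ) :
    Tendsto (fun i => heightFun u (K i) y) atTop (𝓝 (heightFun u K₀ y)) := by
  obtain ⟨t₀, -, -, -, h⟩ := hconv
  -- The margin `1` and the error `min ε 1` place the graph point of `K i` in the same truncation,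
  -- once the upper bound `hup` is known; the lower bound needs this.
  set t := max t₀ (heightFun u K₀ y + 1)
  have ht := h t (le_max_left _ _)
  have hr : 0 < 1 + r⁻¹ := by have := inv_pos.2 F.pos; linarith
  rw [Metric.tendsto_nhds]
  intro ε hε
  set δ := min ε 1 / (1 + r⁻¹)
  have hδ : 0 < δ := div_pos (lt_min hε one_pos) hr
  have hδ' : (1 + r⁻¹) * δ = min ε 1 := mul_div_cancel₀ _ hr.ne'
  have hproj : ∀ K : Set (EuclideanSpace ℝ (Fin n)), hyperProj u (graphMap u (heightFun u K) y) = y :=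
    fun K => F.hyperProj_graph _ _
  have hin : ∀ K : Set (EuclideanSpace ℝ (Fin n)),
      inner ℝ (graphMap u (heightFun u K) y) u = heightFun u K y := fun K => F.inner_coe_add_smul _ _
  filter_upwards [ht.eventually (gt_mem_nhds (ENNReal.ofReal_pos.2 hδ))] with i hi
  have h0mem : graphMap u (heightFun u K₀) y ∈
      K₀ ∩ truncCone (C : Set (EuclideanSpace ℝ (Fin n))) u t := by
    refine ⟨F.graphMap_mem hK₀ y, hK₀.subset (F.graphMap_mem hK₀ y), ?_⟩
    rw [hin]
    exact (le_add_of_nonneg_right zero_le_one).trans (le_max_right _ _)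
  have hup : heightFun u (K i) y < heightFun u K₀ y + min ε 1 := by
    rw [Metric.hausdorffEDist_comm] at hi
    obtain ⟨x, hx, hxd⟩ := Metric.exists_edist_lt_of_hausdorffEDist_lt h0mem hi
    have h1 := F.heightFun_le_add_dist (hK i) (p := graphMap u (heightFun u K₀) y) hx.1
    rw [hproj, hin] at h1
    rw [edist_dist, ENNReal.ofReal_lt_ofReal_iff hδ] at hxd
    have := mul_lt_mul_of_pos_left hxd hr
    linarith
  have himem : graphMap u (heightFun u (K i)) y ∈
      K i ∩ truncCone (C : Set (EuclideanSpace ℝ (Fin n))) u t := by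
    refine ⟨F.graphMap_mem (hK i) y, (hK i).subset (F.graphMap_mem (hK i) y), ?_⟩
    rw [hin]
    have := min_le_right ε 1
    have := le_max_right t₀ (heightFun u K₀ y + 1)
    linarith
  have hlo : heightFun u K₀ y < heightFun u (K i) y + min ε 1 := by
    obtain ⟨x, hx, hxd⟩ := Metric.exists_edist_lt_of_hausdorffEDist_lt himem hi
    have h1 := F.heightFun_le_add_dist hK₀ (p := graphMap u (heightFun u (K i)) y) hx.1
    rw [hproj, hin] at h1
    rw [edist_dist, ENNReal.ofReal_lt_ofReal_iff hδ] at hxd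
    have := mul_lt_mul_of_pos_left hxd hr
    linarith
  rw [Real.dist_eq, abs_lt]
  have := min_le_left ε 1
  constructor <;> linarith

end ConeFrame

end Frame


/-! ### The Gaussian density, its push-forward, and weak convergence -/

/-- The normalization of the Gaussian surface area with respect to `μH[n - 1]`. -/
def gaussConst (n : ℕ) : ℝ≥0 :=
  (ENNReal.ofReal (1 / (2 * Real.pi) ^ ((n : ℝ) / 2)) *
    volume (Metric.ball (0 : EuclideanSpace ℝ (Fin (n - 1))) (1 / 2))).toNNReal

theorem coe_gaussConst (n : ℕ) : (gaussConst n : ℝ≥0∞) =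
    ENNReal.ofReal (1 / (2 * Real.pi) ^ ((n : ℝ) / 2)) *
      volume (Metric.ball (0 : EuclideanSpace ℝ (Fin (n - 1))) (1 / 2)) :=
  ENNReal.coe_toNNReal (ENNReal.mul_ne_top ENNReal.ofReal_ne_top measure_ball_lt_top.ne)

/-- The Gaussian weight `exp (-|x|² / 2)`. -/
def gaussWeight (x : EuclideanSpace ℝ (Fin n)) : ℝ≥0 := (Real.exp (-‖x‖ ^ 2 / 2)).toNNReal

theorem continuous_gaussWeight : Continuous (gaussWeight (n := n)) := by
  unfold gaussWeight; fun_prop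

/-- The density on `u^⊥` of the Gaussian surface area of `K` inside the interior of `C`. -/
def gaussDensity (C : Set (EuclideanSpace ℝ (Fin n))) (u : EuclideanSpace ℝ (Fin n))
    (K : Set (EuclideanSpace ℝ (Fin n))) : (Submodule.span ℝ {u})ᗮ → ℝ≥0 :=
  (graphMap u (heightFun u K) ⁻¹' interior C).indicator fun y =>
    gaussConst n * (graphFactor u (fderiv ℝ (heightFun u K) y) *
      gaussWeight (graphMap u (heightFun u K) y))

theorem gaussDensity_of_mem {C : Set (EuclideanSpace ℝ (Fin n))} {u : EuclideanSpace ℝ (Fin n)}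
    {K : Set (EuclideanSpace ℝ (Fin n))} {y : (Submodule.span ℝ {u})ᗮ}
    (hy : graphMap u (heightFun u K) y ∈ interior C) :
    gaussDensity C u K y = gaussConst n * (graphFactor u (fderiv ℝ (heightFun u K) y) *
      gaussWeight (graphMap u (heightFun u K) y)) :=
  indicator_of_mem (s := graphMap u (heightFun u K) ⁻¹' interior C) hy _

theorem gaussDensity_of_notMem {C : Set (EuclideanSpace ℝ (Fin n))} {u : EuclideanSpace ℝ (Fin n)}
    {K : Set (EuclideanSpace ℝ (Fin n))} {y : (Submodule.span ℝ {u})ᗮ}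
    (hy : graphMap u (heightFun u K) y ∉ interior C) : gaussDensity C u K y = 0 :=
  indicator_of_notMem (s := graphMap u (heightFun u K) ⁻¹' interior C) hy _

open scoped Classical in
/-- The outer unit normal of `K` at the boundary point over `y`, with the junk value `-u` if it is
not in `Ω_{C°}`. -/
def gaussMap {C : Set (EuclideanSpace ℝ (Fin n))} {u : EuclideanSpace ℝ (Fin n)}
    (hu' : -u ∈ sphInterior (polarCone C)) (K : Set (EuclideanSpace ℝ (Fin n)))
    (y : (Submodule.span ℝ {u})ᗮ) : sphInterior (polarCone C) :=
  if h : normalDir u (fderiv ℝ (heightFun u K) y) ∈ sphInterior (polarCone C) then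
    ⟨normalDir u (fderiv ℝ (heightFun u K) y), h⟩ else ⟨-u, hu'⟩

theorem coe_gaussMap {C : Set (EuclideanSpace ℝ (Fin n))} {u : EuclideanSpace ℝ (Fin n)}
    (hu' : -u ∈ sphInterior (polarCone C)) {K : Set (EuclideanSpace ℝ (Fin n))}
    {y : (Submodule.span ℝ {u})ᗮ}
    (h : normalDir u (fderiv ℝ (heightFun u K) y) ∈ sphInterior (polarCone C)) :
    (gaussMap hu' K y : EuclideanSpace ℝ (Fin n)) = normalDir u (fderiv ℝ (heightFun u K) y) := by
  rw [gaussMap, dif_pos h]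

theorem measurable_gaussMap {C : Set (EuclideanSpace ℝ (Fin n))} {u : EuclideanSpace ℝ (Fin n)}
    (hu : ‖u‖ = 1) (hu' : -u ∈ sphInterior (polarCone C)) (K : Set (EuclideanSpace ℝ (Fin n))) :
    Measurable (gaussMap hu' K) := by
  classical
  have hN : Measurable fun y => normalDir u (fderiv ℝ (heightFun u K) y) :=
    (continuous_normalDir hu).measurable.comp (measurable_fderiv ℝ _)
  have hΩ : MeasurableSet (sphInterior (polarCone C)) :=
    isOpen_interior.measurableSet.inter Metric.isClosed_sphere.measurableSet
  refine (MeasurableEmbedding.subtype_coe hΩ).measurable_comp_iff.1 ?_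
  have : Subtype.val ∘ gaussMap hu' K = fun y =>
      if normalDir u (fderiv ℝ (heightFun u K) y) ∈ sphInterior (polarCone C) then
        normalDir u (fderiv ℝ (heightFun u K) y) else -u := by
    funext y
    unfold gaussMap
    simp only [Function.comp_apply]
    split_ifs <;> rfl
  rw [this]
  exact Measurable.ite (hN hΩ) hN measurable_const

/-- The push-forward of the Gaussian surface area under the Gauss map. -/
def gaussMeasure {C : Set (EuclideanSpace ℝ (Fin n))} {u : EuclideanSpace ℝ (Fin n)}
    (hu' : -u ∈ sphInterior (polarCone C)) (K : Set (EuclideanSpace ℝ (Fin n))) :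
    Measure (sphInterior (polarCone C)) :=
  ((hyperMeasure u).withDensity fun y => (gaussDensity C u K y : ℝ≥0∞)).map (gaussMap hu' K)

theorem integrable_exp_neg_norm_sq (u : EuclideanSpace ℝ (Fin n)) :
    Integrable (fun y : (Submodule.span ℝ {u})ᗮ => Real.exp (-‖y‖ ^ 2 / 2)) (hyperMeasure u) := by
  have h : Integrable (fun y : (Submodule.span ℝ {u})ᗮ => Real.exp (-‖y‖ ^ 2 / 2)) volume := by
    have := (GaussianFourier.integrable_cexp_neg_mul_sq_norm_add (V := (Submodule.span ℝ {u})ᗮ)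
      (b := 1 / 2) (by norm_num) 0 0).norm
    refine this.congr (Eventually.of_forall fun y => ?_)
    simp only [Complex.norm_exp]
    congr 1
    simp only [zero_mul, add_zero]
    norm_cast
    rw [← Complex.ofReal_one, ← Complex.ofReal_ofNat, ← Complex.ofReal_div, ← Complex.ofReal_neg,
      ← Complex.ofReal_mul, Complex.ofReal_re]
    ring
  rw [Measure.isAddLeftInvariant_eq_smul (hyperMeasure u) volume]
  exact h.smul_measure_nnreal

theorem finrank_orthogonal_span {u : EuclideanSpace ℝ (Fin n)} (hu : ‖u‖ = 1) :
    finrank ℝ (Submodule.span ℝ {u})ᗮ = n - 1 := by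
  have h := (Submodule.span ℝ {u}).finrank_add_finrank_orthogonal
  rw [finrank_span_singleton (norm_ne_zero_iff.1 (by rw [hu]; exact one_ne_zero)),
    finrank_euclideanSpace_fin] at h
  omega

namespace ConeFrame

variable {C : ProperCone ℝ (EuclideanSpace ℝ (Fin n))} {u : EuclideanSpace ℝ (Fin n)} {r : ℝ}
  {K : Set (EuclideanSpace ℝ (Fin n))} (F : ConeFrame C u r)
include F

theorem measurable_gaussDensity (hK : IsPseudoCone (C : Set (EuclideanSpace ℝ (Fin n))) K) :
    Measurable (gaussDensity (C : Set (EuclideanSpace ℝ (Fin n))) u K) := by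
  have hG := continuous_graphMap u (F.continuous_heightFun hK)
  refine Measurable.indicator ?_ (hG.measurable isOpen_interior.measurableSet)
  exact (((continuous_graphFactor F.norm_eq).measurable.comp (measurable_fderiv ℝ _)).mul
    (continuous_gaussWeight.comp hG).measurable).const_mul _

/-- The bound is independent of `K`, because `r⁻¹` is a common Lipschitz constant and a graph point
is at least as long as its base point. It serves for finiteness and for dominated convergence. -/
theorem gaussDensity_le (hK : IsPseudoCone (C : Set (EuclideanSpace ℝ (Fin n))) K)
    (y : (Submodule.span ℝ {u})ᗮ) :
    (gaussDensity (C : Set (EuclideanSpace ℝ (Fin n))) u K y : ℝ) ≤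
      gaussConst n * (1 + r⁻¹) ^ finrank ℝ (Submodule.span ℝ {u})ᗮ * Real.exp (-‖y‖ ^ 2 / 2) := by
  have hr := inv_pos.2 F.pos
  by_cases hy : y ∈ graphMap u (heightFun u K) ⁻¹' interior (C : Set (EuclideanSpace ℝ (Fin n)))
  · rw [gaussDensity_of_mem hy, NNReal.coe_mul, NNReal.coe_mul, mul_assoc]
    refine mul_le_mul_of_nonneg_left (mul_le_mul ?_ ?_ (NNReal.coe_nonneg _) (by positivity))
      (NNReal.coe_nonneg _)
    · have := graphFactor_le F.norm_eq (fderiv ℝ (heightFun u K) y)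
        (norm_fderiv_le_of_lipschitz ℝ (F.lipschitz_heightFun hK))
      exact_mod_cast this
    · rw [gaussWeight, Real.coe_toNNReal _ (Real.exp_pos _).le, Real.exp_le_exp]
      have := norm_le_norm_coe_add_smul F.norm_eq y (heightFun u K y)
      have h2 := pow_le_pow_left₀ (norm_nonneg _) this 2
      rw [graphMap]
      linarith
  · rw [gaussDensity_of_notMem hy, NNReal.coe_zero]
    positivity

theorem isFiniteMeasure_gaussMeasure
    (hu' : -u ∈ sphInterior (polarCone (C : Set (EuclideanSpace ℝ (Fin n)))))
    (hK : IsPseudoCone (C : Set (EuclideanSpace ℝ (Fin n))) K) :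
    IsFiniteMeasure (gaussMeasure hu' K) := by
  have h : Integrable (fun y => (gaussDensity (C : Set (EuclideanSpace ℝ (Fin n))) u K y : ℝ))
      (hyperMeasure u) := by
    refine ((integrable_exp_neg_norm_sq u).const_mul
      (gaussConst n * (1 + r⁻¹) ^ finrank ℝ (Submodule.span ℝ {u})ᗮ)).mono'
      (F.measurable_gaussDensity hK).coe_nnreal_real.aestronglyMeasurable
      (Eventually.of_forall fun y => ?_)
    rw [Real.norm_of_nonneg (NNReal.coe_nonneg _)]
    exact F.gaussDensity_le hK y
  have : IsFiniteMeasure ((hyperMeasure u).withDensity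
      fun y => (gaussDensity (C : Set (EuclideanSpace ℝ (Fin n))) u K y : ℝ≥0∞)) := by
    refine isFiniteMeasure_withDensity ?_
    have := h.lintegral_lt_top
    simpa using this.ne
  exact Measure.isFiniteMeasure_map _ _

/-- The push-forward measure is the Gaussian surface area measure. -/
theorem gaussMeasure_apply {ω : Set (EuclideanSpace ℝ (Fin n))} (hω : IsCompact ω)
    (hω_sub : ω ⊆ sphInterior (polarCone (C : Set (EuclideanSpace ℝ (Fin n)))))
    (hu' : -u ∈ sphInterior (polarCone (C : Set (EuclideanSpace ℝ (Fin n)))))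
    (hK : IsDetermined (C : Set (EuclideanSpace ℝ (Fin n))) ω K)
    {A : Set (sphInterior (polarCone (C : Set (EuclideanSpace ℝ (Fin n)))))}
    (hA : MeasurableSet A) :
    gaussMeasure hu' K A =
      gaussSurfaceArea (C : Set (EuclideanSpace ℝ (Fin n))) K (Subtype.val '' A) := by
  have hP := hK.isPseudoCone
  set f := heightFun u K with hf
  have hfc := F.continuous_heightFun hP
  have hGc := continuous_graphMap u hfc
  set D := {y | DifferentiableAt ℝ f y} with hD
  have hDm : MeasurableSet D := measurableSet_of_differentiableAt ℝ f
  have hDae : ∀ᵐ y ∂(hyperMeasure u), y ∈ D := (F.lipschitz_heightFun hP).ae_differentiableAt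
  set I := graphMap u f ⁻¹' interior (C : Set (EuclideanSpace ℝ (Fin n))) with hI
  have hIm : MeasurableSet I := hGc.measurable isOpen_interior.measurableSet
  have hTm : MeasurableSet (gaussMap hu' K ⁻¹' A) := measurable_gaussMap F.norm_eq hu' K hA
  set s := gaussMap hu' K ⁻¹' A ∩ I ∩ D with hs
  have hsm : MeasurableSet s := (hTm.inter hIm).inter hDm
  have hAΩ : Subtype.val '' A ⊆ sphInterior (polarCone (C : Set (EuclideanSpace ℝ (Fin n)))) := by
    rintro _ ⟨v, -, rfl⟩
    exact v.2
  have hpt : ∀ y ∈ I ∩ D, (graphMap u f y ∈ inverseGaussImage (C : Set (EuclideanSpace ℝ (Fin n))) K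
      (Subtype.val '' A) ↔ gaussMap hu' K y ∈ A) := by
    rintro y ⟨hyI, hyD⟩
    have hmem : normalDir u (fderiv ℝ f y) ∈ sphInterior (polarCone (C : Set (EuclideanSpace ℝ (Fin n)))) :=
      hω_sub (F.normalDir_mem hω hω_sub hK hyD hyI)
    have hfr : graphMap u f y ∈ frontier K := by rw [F.frontier_eq hP]; exact mem_range_self y
    have h1 : graphMap u f y ∈ inverseGaussImage (C : Set (EuclideanSpace ℝ (Fin n))) K
      (Subtype.val '' A) ↔ ∃ v ∈ Subtype.val '' A, inner ℝ (graphMap u f y) v = supportFun K v :=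
      ⟨fun h => h.2, fun h => ⟨⟨hfr, hyI⟩, h⟩⟩
    rw [h1, F.exists_mem_iff_normalDir_mem hP hyD hAΩ, ← coe_gaussMap hu' hmem,
      Subtype.val_injective.mem_set_image]
  -- The two sets differ only over points of non-differentiability, whose graph is null. This also
  -- makes measurability of the inverse Gauss image unnecessary.
  have hae : inverseGaussImage (C : Set (EuclideanSpace ℝ (Fin n))) K (Subtype.val '' A)
      =ᵐ[μH[finrank ℝ (Submodule.span ℝ {u})ᗮ]] graphMap u f '' s := by
    have hsub : graphMap u f '' s ⊆
        inverseGaussImage (C : Set (EuclideanSpace ℝ (Fin n))) K (Subtype.val '' A) := by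
      rintro _ ⟨y, ⟨⟨hyA, hyI⟩, hyD⟩, rfl⟩
      exact (hpt y ⟨hyI, hyD⟩).2 hyA
    refine EventuallyLE.antisymm (ae_le_set.2 ?_) (Eventually.of_forall fun _ h => hsub h)
    refine measure_mono_null ?_
      (hausdorffMeasure_graphMap_not_differentiable F.norm_eq (F.lipschitz_heightFun hP))
    rintro x ⟨hx, hxs⟩
    have hxr := hx.1.1
    rw [F.frontier_eq hP] at hxr
    obtain ⟨y, rfl⟩ := hxr
    refine ⟨y, fun hyD => hxs ⟨y, ⟨⟨?_, hx.1.2⟩, hyD⟩, rfl⟩, rfl⟩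
    exact (hpt y ⟨hx.1.2, hyD⟩).1 hx
  have hdim : ((n - 1 : ℕ) : ℝ) = (finrank ℝ (Submodule.span ℝ {u})ᗮ : ℝ) := by
    rw [finrank_orthogonal_span F.norm_eq]
  rw [gaussSurfaceArea, hausdorff, Measure.restrict_smul, lintegral_smul_measure, smul_eq_mul,
    ← mul_assoc, ← coe_gaussConst, hdim, Measure.restrict_congr_set hae]
  have harea := lintegral_graphMap_image F.norm_eq hfc hsm (fun y hy => hy.2)
    (fun x => (gaussWeight x : ℝ≥0∞)) continuous_gaussWeight.measurable.coe_nnreal_ennreal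
  change _ = (gaussConst n : ℝ≥0∞) * ∫⁻ x in graphMap u f '' s, (gaussWeight x : ℝ≥0∞) ∂_
  rw [harea, gaussMeasure, Measure.map_apply (measurable_gaussMap F.norm_eq hu' K) hA,
    withDensity_apply _ hTm, ← lintegral_const_mul' _ _ ENNReal.coe_ne_top]
  have h2 : (fun y => (gaussDensity (C : Set (EuclideanSpace ℝ (Fin n))) u K y : ℝ≥0∞)) =
      I.indicator fun y => (gaussConst n : ℝ≥0∞) * ((graphFactor u (fderiv ℝ f y) : ℝ≥0∞) *
        (gaussWeight (graphMap u f y) : ℝ≥0∞)) := by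
    funext y
    by_cases hy : y ∈ I
    · rw [gaussDensity_of_mem hy, indicator_of_mem hy]; push_cast; rfl
    · rw [gaussDensity_of_notMem hy, indicator_of_notMem hy]; rfl
  have h3 : s =ᵐ[hyperMeasure u] (gaussMap hu' K ⁻¹' A ∩ I : Set _) :=
    inter_ae_eq_left_of_ae_eq_univ (eventuallyEq_univ.2 hDae)
  rw [h2, setLIntegral_indicator hIm, inter_comm, setLIntegral_congr h3]

/-- Weak convergence of the push-forward measures, tested against a bounded continuous function. -/
theorem tendsto_integral_gaussMeasure
    (hC : (interior (C : Set (EuclideanSpace ℝ (Fin n)))).Nonempty)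
    {ω : Set (EuclideanSpace ℝ (Fin n))} (hω : IsCompact ω)
    (hω_sub : ω ⊆ sphInterior (polarCone (C : Set (EuclideanSpace ℝ (Fin n)))))
    (hu' : -u ∈ sphInterior (polarCone (C : Set (EuclideanSpace ℝ (Fin n)))))
    {K : ℕ → Set (EuclideanSpace ℝ (Fin n))} {K₀ : Set (EuclideanSpace ℝ (Fin n))}
    (hK : ∀ i, IsDetermined (C : Set (EuclideanSpace ℝ (Fin n))) ω (K i))
    (hK₀ : IsDetermined (C : Set (EuclideanSpace ℝ (Fin n))) ω K₀)
    (hconv : SchneiderTendsto (C : Set (EuclideanSpace ℝ (Fin n))) u K K₀)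
    (φ : BoundedContinuousFunction (sphInterior (polarCone (C : Set (EuclideanSpace ℝ (Fin n))))) ℝ) :
    Tendsto (fun i => ∫ v, φ v ∂(gaussMeasure hu' (K i))) atTop
      (𝓝 (∫ v, φ v ∂(gaussMeasure hu' K₀))) := by
  have hP := fun i => (hK i).isPseudoCone
  have hP₀ := hK₀.isPseudoCone
  have hint : ∀ K, IsPseudoCone (C : Set (EuclideanSpace ℝ (Fin n))) K →
      ∫ v, φ v ∂(gaussMeasure hu' K) = ∫ y,
        (gaussDensity (C : Set (EuclideanSpace ℝ (Fin n))) u K y : ℝ) * φ (gaussMap hu' K y)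
          ∂(hyperMeasure u) := fun K hP => by
    rw [gaussMeasure, integral_map (measurable_gaussMap F.norm_eq hu' K).aemeasurable
      φ.continuous.aestronglyMeasurable,
      integral_withDensity_eq_integral_smul (F.measurable_gaussDensity hP)]
    rfl
  simp only [hint _ (hP _), hint _ hP₀]
  refine tendsto_integral_of_dominated_convergence (fun y =>
    gaussConst n * (1 + r⁻¹) ^ finrank ℝ (Submodule.span ℝ {u})ᗮ * Real.exp (-‖y‖ ^ 2 / 2) * ‖φ‖)
    (fun i => ?_) (((integrable_exp_neg_norm_sq u).const_mul _).mul_const _)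
    (fun i => Eventually.of_forall fun y => ?_) ?_
  · exact ((F.measurable_gaussDensity (hP i)).coe_nnreal_real.mul
      (φ.continuous.measurable.comp (measurable_gaussMap F.norm_eq hu' (K i)))).aestronglyMeasurable
  · rw [norm_mul, Real.norm_of_nonneg (NNReal.coe_nonneg _)]
    exact mul_le_mul (F.gaussDensity_le (hP i) y) (φ.norm_coe_le_norm _) (norm_nonneg _)
      ((NNReal.coe_nonneg _).trans (F.gaussDensity_le (hP i) y))
  have hdiff : ∀ᵐ y ∂(hyperMeasure u), ∀ i, DifferentiableAt ℝ (heightFun u (K i)) y :=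
    ae_all_iff.2 fun i => (F.lipschitz_heightFun (hP i)).ae_differentiableAt
  have hdiff₀ : ∀ᵐ y ∂(hyperMeasure u), DifferentiableAt ℝ (heightFun u K₀) y :=
    (F.lipschitz_heightFun hP₀).ae_differentiableAt
  filter_upwards [hdiff, hdiff₀] with y hd hd₀
  have hheight := F.tendsto_heightFun hP hP₀ hconv
  have hfd := tendsto_fderiv_of_convexOn (fun i => F.convexOn_heightFun (hP i)) hheight hd hd₀
  have hnor := ((continuous_normalDir F.norm_eq).tendsto _).comp hfd
  have hG : Tendsto (fun i => graphMap u (heightFun u (K i)) y) atTop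
      (𝓝 (graphMap u (heightFun u K₀) y)) := ((hheight y).smul_const u).const_add _
  by_cases hy : graphMap u (heightFun u K₀) y ∈ interior (C : Set (EuclideanSpace ℝ (Fin n)))
  · have hev : ∀ᶠ i in atTop, graphMap u (heightFun u (K i)) y ∈
        interior (C : Set (EuclideanSpace ℝ (Fin n))) :=
      hG.eventually (isOpen_interior.mem_nhds hy)
    refine Tendsto.mul (NNReal.tendsto_coe.2 ?_) ((φ.continuous.tendsto _).comp ?_)
    · rw [gaussDensity_of_mem hy]
      refine Tendsto.congr' (hev.mono fun i hi => (gaussDensity_of_mem hi).symm)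
        (Tendsto.const_mul _ (Tendsto.mul ?_ ((continuous_gaussWeight.tendsto _).comp hG)))
      exact ((continuous_graphFactor F.norm_eq).tendsto _).comp hfd
    · rw [tendsto_subtype_rng, coe_gaussMap hu' (hω_sub (F.normalDir_mem hω hω_sub hK₀ hd₀ hy))]
      refine Tendsto.congr' (hev.mono fun i hi => ?_) hnor
      exact (coe_gaussMap hu' (hω_sub (F.normalDir_mem hω hω_sub (hK i) (hd i) hi))).symm
  -- Otherwise normals of infinitely many `K i` lie in the closed set `ω`, hence so does their
  -- limit, which is impossible at a boundary point of `C`. The integrands are therefore eventually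
  -- `0`, like the limit, and the junk value of `gaussMap` plays no role.
  · have hev : ∀ᶠ i in atTop, graphMap u (heightFun u (K i)) y ∉
        interior (C : Set (EuclideanSpace ℝ (Fin n))) := by
      by_contra hfr
      rw [not_eventually] at hfr
      refine F.normalDir_notMem hC hP₀ hd₀ hy (hω_sub ?_)
      refine hω.isClosed.mem_of_frequently_of_tendsto (hfr.mono fun i hi => ?_) hnor
      exact F.normalDir_mem hω hω_sub (hK i) (hd i) (not_not.1 hi)
    rw [gaussDensity_of_notMem hy, NNReal.coe_zero, zero_mul]
    refine tendsto_const_nhds.congr' (hev.mono fun i hi => ?_)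
    beta_reduce
    rw [gaussDensity_of_notMem hi, NNReal.coe_zero, zero_mul]

end ConeFrame

theorem exists_coneFrame {C : ProperCone ℝ (EuclideanSpace ℝ (Fin n))}
    {u : EuclideanSpace ℝ (Fin n)} (hu : u ∈ sphInterior (C : Set (EuclideanSpace ℝ (Fin n))))
    (hu' : -u ∈ sphInterior (polarCone (C : Set (EuclideanSpace ℝ (Fin n))))) :
    ∃ r, ConeFrame C u r := by
  obtain ⟨r, hr, h⟩ := Metric.nhds_basis_closedBall.mem_iff.1 (mem_interior_iff_mem_nhds.1 hu.1)
  refine ⟨r, norm_eq_of_mem_sphInterior hu, hr, fun x hx => h ?_, fun x hx => ?_⟩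
  · rwa [Metric.mem_closedBall, dist_eq_norm]
  · have := mem_polarCone_of_mem_sphInterior hu' x hx
    rw [inner_neg_left, real_inner_comm] at this
    linarith

end GaussPseudoCone

end

/-- Weak continuity of Gaussian surface area measures of `C`-determined sets. The set functions
`S_{γ_n}(K i, ·)` and `S_{γ_n}(K₀, ·)` are finite Borel measures on `Ω_{C°}`, and the former
converge weakly to the latter (the topology of `FiniteMeasure` is that of weak convergence,
tested against bounded continuous functions). -/
theorem lemma3p4 (n : ℕ) (C : ProperCone ℝ (EuclideanSpace ℝ (Fin n)))
    (hC_int : (interior (C : Set (EuclideanSpace ℝ (Fin n)))).Nonempty)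
    (hC_pointed : ∀ x, x ∈ C → -x ∈ C → x = 0)
    (u : EuclideanSpace ℝ (Fin n))
    (hu : u ∈ GaussPseudoCone.sphInterior (C : Set (EuclideanSpace ℝ (Fin n))))
    (hu' : -u ∈ GaussPseudoCone.sphInterior
      (GaussPseudoCone.polarCone (C : Set (EuclideanSpace ℝ (Fin n)))))
    (ω : Set (EuclideanSpace ℝ (Fin n))) (hω : IsCompact ω) (hω_ne : ω.Nonempty)
    (hω_sub : ω ⊆ GaussPseudoCone.sphInterior
      (GaussPseudoCone.polarCone (C : Set (EuclideanSpace ℝ (Fin n)))))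
    (K : ℕ → Set (EuclideanSpace ℝ (Fin n))) (K₀ : Set (EuclideanSpace ℝ (Fin n)))
    (hK : ∀ i, GaussPseudoCone.IsDetermined (C : Set (EuclideanSpace ℝ (Fin n))) ω (K i))
    (hK₀ : GaussPseudoCone.IsDetermined (C : Set (EuclideanSpace ℝ (Fin n))) ω K₀)
    (hconv : GaussPseudoCone.SchneiderTendsto (C : Set (EuclideanSpace ℝ (Fin n))) u K K₀) :
    ∃ (S : ℕ → FiniteMeasure (GaussPseudoCone.sphInterior
          (GaussPseudoCone.polarCone (C : Set (EuclideanSpace ℝ (Fin n))))))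
      (S₀ : FiniteMeasure (GaussPseudoCone.sphInterior
          (GaussPseudoCone.polarCone (C : Set (EuclideanSpace ℝ (Fin n)))))),
      (∀ i, GaussPseudoCone.IsGaussSurfaceAreaMeasure
        (C : Set (EuclideanSpace ℝ (Fin n))) (K i) (S i)) ∧
      GaussPseudoCone.IsGaussSurfaceAreaMeasure (C : Set (EuclideanSpace ℝ (Fin n))) K₀ S₀ ∧
      Tendsto S atTop (𝓝 S₀) := by
  obtain ⟨r, F⟩ := GaussPseudoCone.exists_coneFrame hu hu'
  have hfin := fun i => F.isFiniteMeasure_gaussMeasure hu' (hK i).isPseudoCone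
  have hfin₀ := F.isFiniteMeasure_gaussMeasure hu' hK₀.isPseudoCone
  refine ⟨fun i => ⟨GaussPseudoCone.gaussMeasure hu' (K i), hfin i⟩,
    ⟨GaussPseudoCone.gaussMeasure hu' K₀, hfin₀⟩, fun i A hA => ?_, fun A hA => ?_, ?_⟩
  · exact F.gaussMeasure_apply hω hω_sub hu' (hK i) hA
  · exact F.gaussMeasure_apply hω hω_sub hu' hK₀ hA
  · exact FiniteMeasure.tendsto_of_forall_integral_tendsto
      (F.tendsto_integral_gaussMeasure hC_int hω hω_sub hu' hK hK₀ hconv)
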